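/- Let $e,d\in\mathbb N$, $T\ge 0$, $p\in[1,2[$, $\gamma>p$ and $a\in\mathbb R^e$. Let $Z:[0,T]\to\mathbb R^d$ be continuous with finite $p$-variation, and let $f:\mathbb R^e\to\mathcal M_{e,d}(\mathbb R)$ be $\gamma$-Lipschitz in the sense of Stein: with $k$ the largest integer $<\gamma$, $f$ is $C^k$, $f$ and its derivatives up to order $k$ are bounded, and $D^kf$ is $(\gamma-k)$-Hölder continuous. Let $C:[0,T]\rightrightarrows\mathbb R^e$ be a multifunction with convex compact values, continuous for the Hausdorff distance, such that there are $r>0$ and a continuous selection $c$ of $C$ with $\overline B(c(t),r)\subset\mathrm{int}\,C(t)$ for every $t\in[0,T]$ (Assumption 1). A solution is a pair $(X,Y)$ of maps $[0,T]\to\mathbb R^e$ such that, for some $H:[0,T]\to\mathbb R^e$, $$X(t)=H(t)+Y(t),\qquad H(t)=\int_0^t f(X(s))\,dZ(s)\qquad(t\in[0,T]),$$ $$-\frac{dDY}{d|DY|}(t)\in N_{C(t)-H(t)}(Y(t))\quad |DY|\text{-a.e.},\qquad Y(0)=a.$$ Here $Y$ is continuous of bounded variation, $DY$ is its differential measure,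 $|DY|$ is the variation measure of $DY$, and $N_K(x)$ is the normal cone of $K$ at $x$ (empty if $x\notin K$). The integral is Young's integral (the limit of left Riemann sums as the mesh tends to $0$), $f\circ X$ being continuous with finite $r$-variation for some $r\ge1$ with $\frac1p+\frac1r>1$. Write $x(u,v):=x(v)-x(u)$. Let $(X,Y)$ and $(X^*,Y^*)$ be two solutions and let $0\le s<t\le T$. Consider the condition $$\int_u^v\langle X(u,r)-X^*(u,r),\,d(Y-Y^*)(r)\rangle\le 0\qquad\text{for all } s\le u<v\le t.\tag{$*$}$$ 1. $X(r)=X^*(r)$ and $Y(s,r)=Y^*(s,r)$ for all $r\in[s,t]$ if and only if $X(s)=X^*(s)$ and $(*)$ holds. 2. $(X,Y)=(X^*,Y^*)$ on $[s,t]$ if and only if $X(s)=X^*(s)$, $Y(s)=Y^*(s)$ and $(*)$ holds. 3. If $s=0$, then $(X,Y)=(X^*,Y^*)$ on $[0,t]$ if and only if $X(0)=X^*(0)$ and $(*)$ holds. -/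

import Mathlib

open Set Filter Topology MeasureTheory
open scoped ENNReal

noncomputable section

namespace Sweeping

/-- The `p`-variation `‖x‖_{p-var,s,t}` of a path `x` on `[s,t]`, as an extended nonnegative real:
the supremum of `(∑ i, ‖x (u (i+1)) - x (u i)‖ ^ p) ^ (1/p)` over finite monotone families of points
of `[s,t]`. -/
def pVariation {E : Type*} [NormedAddCommGroup E] (p : ℝ) (x : ℝ → E) (s t : ℝ) : ℝ≥0∞ :=
  (⨆ q : ℕ × { u : ℕ → ℝ // Monotone u ∧ ∀ i, u i ∈ Icc s t },
    ∑ i ∈ Finset.range q.1, (edist (x (q.2.1 (i + 1))) (x (q.2.1 i))) ^ p) ^ (1 / p)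

/-- `x ∈ C^{p-var}([s,t])`: `x` is continuous on `[s,t]` and has finite `p`-variation there. -/
structure IsCpVar {E : Type*} [NormedAddCommGroup E] (p : ℝ) (x : ℝ → E) (s t : ℝ) : Prop where
  continuousOn : ContinuousOn x (Icc s t)
  finite : pVariation p x s t < ∞

/-- `τ 0 ≤ τ 1 ≤ ⋯ ≤ τ n` is a dissection of `[s,t]`. -/
structure IsDissection (n : ℕ) (τ : ℕ → ℝ) (s t : ℝ) : Prop where
  left : τ 0 = s
  right : τ n = t
  mono : ∀ i < n, τ i ≤ τ (i + 1)

/-- `I = ∫_s^t y dz`: the left Riemann sums `∑ i, y (τ i) (z (τ (i+1)) - z (τ i))` along dissections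
`τ` of `[s,t]` converge to `I` as the mesh of `τ` tends to zero. -/
def IsYoungIntegral {F G : Type*} [NormedAddCommGroup F] [NormedSpace ℝ F]
    [NormedAddCommGroup G] [NormedSpace ℝ G]
    (y : ℝ → F →L[ℝ] G) (z : ℝ → F) (s t : ℝ) (I : G) : Prop :=
  ∀ ε > 0, ∃ δ > 0, ∀ (n : ℕ) (τ : ℕ → ℝ), IsDissection n τ s t →
    (∀ i < n, τ (i + 1) - τ i < δ) →
      ‖(∑ i ∈ Finset.range n, y (τ i) (z (τ (i + 1)) - z (τ i))) - I‖ < ε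

/-- The largest integer strictly smaller than `γ` (for `γ > 0`). -/
def strictFloor (γ : ℝ) : ℕ := ⌈γ⌉₊ - 1

/-- `φ ∈ Lip^γ`, in the sense of Stein: with `k = strictFloor γ`, the map `φ` is `C^k`, bounded with
bounded derivatives up to order `k`, and its `k`-th derivative is `(γ - k)`-Hölder continuous. -/
structure IsLipStein {E G : Type*} [NormedAddCommGroup E] [NormedSpace ℝ E]
    [NormedAddCommGroup G] [NormedSpace ℝ G] (γ : ℝ) (φ : E → G) : Prop where
  contDiff : ContDiff ℝ (strictFloor γ) φ
  bounded : ∀ k ≤ strictFloor γ, ∃ M : ℝ, ∀ x, ‖iteratedFDeriv ℝ k φ x‖ ≤ M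
  holder : ∃ K : ℝ, ∀ x y,
    ‖iteratedFDeriv ℝ (strictFloor γ) φ y - iteratedFDeriv ℝ (strictFloor γ) φ x‖
      ≤ K * ‖y - x‖ ^ (γ - strictFloor γ)

/-- A path of bounded variation on `[0,T]`, extended by constants to `ℝ`, has bounded variation. -/
theorem boundedVariationOn_iccExtend {E : Type*} [NormedAddCommGroup E]
    {T : ℝ} (hT : 0 ≤ T) {Y : ℝ → E}
    (hY : BoundedVariationOn Y (Icc 0 T)) :
    BoundedVariationOn (IccExtend hT ((Icc 0 T).domRestrict Y)) univ := by
  have h : eVariationOn (Y ∘ fun t => (projIcc 0 T hT t : ℝ)) univ ≤ eVariationOn Y (Icc 0 T) :=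
    eVariationOn.comp_le_of_monotoneOn Y _
      (fun a _ b _ hab => monotone_projIcc hT hab) (fun a _ => (projIcc 0 T hT a).2)
  exact ne_top_of_le_ne_top hY h

section Constraint

variable {E : Type*} [NormedAddCommGroup E] [InnerProductSpace ℝ E]

/-- The normal cone of `C` at `x`; it is empty when `x ∉ C`. -/
def normalCone (C : Set E) (x : E) : Set E :=
  { n | x ∈ C ∧ ∀ y ∈ C, inner ℝ n (y - x) ≤ 0 }

/-- The standing assumption on the multifunction `C : [0,T] ⇉ E`: convex compact values, continuity
for the Hausdorff distance, and a continuous selection around which a closed ball of fixed positive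
radius stays in the interior of `C`. -/
structure ConstraintAssumption (T : ℝ) (C : ℝ → Set E) : Prop where
  convex : ∀ t ∈ Icc 0 T, Convex ℝ (C t)
  compact : ∀ t ∈ Icc 0 T, IsCompact (C t)
  hausdorff : ∀ t ∈ Icc 0 T,
    Tendsto (fun u => Metric.hausdorffEDist (C u) (C t)) (𝓝[Icc 0 T] t) (𝓝 0)
  selection : ∃ c : ℝ → E, ContinuousOn c (Icc 0 T) ∧
    (∀ t ∈ Icc 0 T, c t ∈ C t) ∧
    ∃ r > 0, ∀ t ∈ Icc 0 T, Metric.closedBall (c t) r ⊆ interior (C t)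

/-- The differential measure `DY` of a path `Y` of bounded variation on `[0,T]`: the Stieltjes vector
measure of its extension by constants, which is carried by `[0,T]`. -/
def differentialMeasure [CompleteSpace E] {T : ℝ} (hT : 0 ≤ T) {Y : ℝ → E}
    (hY : BoundedVariationOn Y (Icc 0 T)) : VectorMeasure ℝ E :=
  (boundedVariationOn_iccExtend hT hY).vectorMeasure

/-- `-dDY/d|DY|(t) ∈ N_{K(t)}(Y(t))` for `|DY|`-almost every `t`, where `DY` is the differential
measure of the continuous path of bounded variation `Y` on `[0,T]`, and `|DY|` its variation; the
Radon–Nikodym density is the (`|DY|`-a.e. unique) function `ν` with `DY = ν |DY|`. -/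
structure IsSweeping [CompleteSpace E] {T : ℝ} (hT : 0 ≤ T) (K : ℝ → Set E) (Y : ℝ → E) :
    Prop where
  continuousOn : ContinuousOn Y (Icc 0 T)
  boundedVariationOn : BoundedVariationOn Y (Icc 0 T)
  inclusion : ∃ ν : ℝ → E,
    Integrable ν (differentialMeasure hT boundedVariationOn).variation ∧
    differentialMeasure hT boundedVariationOn
      = (differentialMeasure hT boundedVariationOn).variation.withDensityᵥ ν ∧
    ∀ᵐ t ∂(differentialMeasure hT boundedVariationOn).variation, -ν t ∈ normalCone (K t) (Y t)

/-- `(X,Y)` solves, on `[0,T]`,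
`X = H + Y`, `H(t) = ∫_0^t f(X(s)) dZ(s)`, `-dDY/d|DY|(t) ∈ N_{C(t) - H(t)}(Y(t))` `|DY|`-a.e.,
`Y(0) = a`. The integral is Young's integral against the path `Z` of finite `p`-variation:
`f ∘ X` is continuous with finite `r`-variation for some `r ≥ 1` with `1/p + 1/r > 1`. -/
def IsSolution [CompleteSpace E] {F : Type*} [NormedAddCommGroup F] [NormedSpace ℝ F]
    {T : ℝ} (hT : 0 ≤ T) (p : ℝ) (C : ℝ → Set E) (f : E → F →L[ℝ] E) (Z : ℝ → F) (a : E)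
    (X Y : ℝ → E) : Prop :=
  ∃ H : ℝ → E,
    (∀ t ∈ Icc 0 T, X t = H t + Y t) ∧
    (∃ r : ℝ, 1 ≤ r ∧ 1 < 1 / p + 1 / r ∧ IsCpVar r (fun u => f (X u)) 0 T) ∧
    (∀ t ∈ Icc 0 T, IsYoungIntegral (fun u => f (X u)) Z 0 t (H t)) ∧
    IsSweeping hT (fun t => (fun x => x - H t) '' C t) Y ∧
    Y 0 = a

/-- `∫_u^v ⟨X(u,r) - X'(u,r), d(Y - Y')(r)⟩ ≤ 0` for all `s ≤ u < v ≤ t`, where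
`x(u,r) = x(r) - x(u)`. -/
def IncrementMonotone (X Y X' Y' : ℝ → E) (s t : ℝ) : Prop :=
  ∀ u v : ℝ, s ≤ u → u < v → v ≤ t →
    ∃ I : ℝ, IsYoungIntegral (fun r => innerSL ℝ ((X r - X u) - (X' r - X' u)))
      (fun r => Y r - Y' r) u v I ∧ I ≤ 0

end Constraint

end Sweeping

end

/-! Put `W = X - X'`, `h = H - H'` and `V = Y - Y' = W - h`. For exponents below 2, a continuous
path of finite variation has no quadratic variation, so `‖W(u,v)‖² = 2 ∫ ⟨W(u,·), dV⟩ + 2 ∫ ⟨W(u,·),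
dh⟩`. Condition (∗) discards the first integral, and Young's inequality bounds the second by the
product of the `q`-variations of `W` and `h`. Absorbing half of the variation of `W` then bounds it
by that of `h` (`norm_sq_le_of_youngIntegral_nonpos`, `varControl_le_of_norm_sq_le`).

Conversely, `h` is the Young integral of `f ∘ X - f ∘ X'` against `Z`. On an interval starting where
`X = X'`, the Stein regularity of `f` bounds this integrand, in supremum and in `q/α`-variation, by
a constant times the `q`-variation of `W` (`exists_varControl_comp_sub_le`). So the variation of `h`
is at most that of `W` times a factor that is small on short intervals, because `q > p`. The two
bounds together force `W = 0` there, and finitely many short steps cover `[s,t]`. Once `X = X'`, the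
integrals have equal increments, hence so do `Y` and `Y'`.

For the other implication, equal increments make `Y - Y'` constant, and every Riemann sum in (∗) is
zero. -/

namespace Sweeping

/-! ### Superadditive interval functions and dissections -/

/-- A nonnegative function of intervals which is superadditive on `[s,t]`. -/
structure IsControl (ω : ℝ → ℝ → ℝ) (s t : ℝ) : Prop where
  nonneg : ∀ a b, s ≤ a → a ≤ b → b ≤ t → 0 ≤ ω a b
  superadd : ∀ a b c, s ≤ a → a ≤ b → b ≤ c → c ≤ t → ω a b + ω b c ≤ ω a c

namespace IsControl

variable {ω ω' : ℝ → ℝ → ℝ} {s t : ℝ}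

theorem restrict (h : IsControl ω s t) {s' t' : ℝ} (hs : s ≤ s') (ht : t' ≤ t) :
    IsControl ω s' t' :=
  ⟨fun a b h1 h2 h3 => h.nonneg a b (hs.trans h1) h2 (h3.trans ht),
    fun a b c h1 h2 h3 h4 => h.superadd a b c (hs.trans h1) h2 h3 (h4.trans ht)⟩

theorem mono (h : IsControl ω s t) {a b a' b' : ℝ} (hs : s ≤ a) (ha : a ≤ a') (hab : a' ≤ b')
    (hb : b' ≤ b) (ht : b ≤ t) : ω a' b' ≤ ω a b := by
  have h1 := h.superadd a a' b' hs ha hab (hb.trans ht)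
  have h2 := h.superadd a b' b hs (ha.trans hab) hb ht
  have h3 := h.nonneg a a' hs ha (hab.trans (hb.trans ht))
  have h4 := h.nonneg b' b (hs.trans (ha.trans hab)) hb ht
  linarith

theorem add (h : IsControl ω s t) (h' : IsControl ω' s t) :
    IsControl (fun a b => ω a b + ω' a b) s t :=
  ⟨fun a b h1 h2 h3 => add_nonneg (h.nonneg a b h1 h2 h3) (h'.nonneg a b h1 h2 h3),
    fun a b c h1 h2 h3 h4 => by
      linarith [h.superadd a b c h1 h2 h3 h4, h'.superadd a b c h1 h2 h3 h4]⟩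

theorem const_mul (h : IsControl ω s t) {k : ℝ} (hk : 0 ≤ k) :
    IsControl (fun a b => k * ω a b) s t :=
  ⟨fun a b h1 h2 h3 => mul_nonneg hk (h.nonneg a b h1 h2 h3),
    fun a b c h1 h2 h3 h4 => by
      rw [← mul_add]; exact mul_le_mul_of_nonneg_left (h.superadd a b c h1 h2 h3 h4) hk⟩

theorem sum_le (h : IsControl ω s t) {τ : ℕ → ℝ} (n : ℕ) (hmono : ∀ i < n, τ i ≤ τ (i + 1))
    (hs : s ≤ τ 0) (ht : τ n ≤ t) :
    τ 0 ≤ τ n ∧ ∑ i ∈ Finset.range n, ω (τ i) (τ (i + 1)) ≤ ω (τ 0) (τ n) := by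
  induction n with
  | zero => exact ⟨le_rfl, by simpa using h.nonneg _ _ hs le_rfl ht⟩
  | succ n ih =>
    have hn := hmono n n.lt_succ_self
    obtain ⟨h1, h2⟩ := ih (fun i hi => hmono i (hi.trans n.lt_succ_self)) (hn.trans ht)
    refine ⟨h1.trans hn, ?_⟩
    rw [Finset.sum_range_succ]
    linarith [h.superadd _ _ _ hs h1 hn ht]

end IsControl

theorem IsDissection.monotoneOn {n : ℕ} {τ : ℕ → ℝ} {s t : ℝ} (h : IsDissection n τ s t)
    {i j : ℕ} (hij : i ≤ j) (hj : j ≤ n) : τ i ≤ τ j := by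
  induction j, hij using Nat.le_induction with
  | base => exact le_rfl
  | succ j _ ih => exact (ih (by omega)).trans (h.mono j (by omega))

theorem IsDissection.mem_Icc {n : ℕ} {τ : ℕ → ℝ} {s t : ℝ} (h : IsDissection n τ s t)
    {i : ℕ} (hi : i ≤ n) : τ i ∈ Icc s t :=
  ⟨h.left ▸ h.monotoneOn (Nat.zero_le i) hi, h.right ▸ h.monotoneOn hi le_rfl⟩

/-! ### Powers of the variation as controls -/

section PowVar

variable {E : Type*} [NormedAddCommGroup E]

/-- The `q`-th power of the `q`-variation. -/
noncomputable def powVar (q : ℝ) (x : ℝ → E) (s t : ℝ) : ℝ≥0∞ :=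
  ⨆ w : ℕ × { u : ℕ → ℝ // Monotone u ∧ ∀ i, u i ∈ Icc s t },
    ∑ i ∈ Finset.range w.1, (edist (x (w.2.1 (i + 1))) (x (w.2.1 i))) ^ q

theorem IsCpVar.powVar_ne_top {p : ℝ} (hp : 0 < p) {x : ℝ → E} {s t : ℝ} (h : IsCpVar p x s t) :
    powVar p x s t ≠ ∞ :=
  ((ENNReal.rpow_lt_top_iff_of_pos (by positivity : 0 < 1 / p)).1 h.finite).ne

theorem powVar_mono (q : ℝ) (x : ℝ → E) {s t s' t' : ℝ} (hs : s ≤ s') (ht : t' ≤ t) :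
    powVar q x s' t' ≤ powVar q x s t := by
  refine iSup_le fun w => ?_
  exact le_iSup (fun w : ℕ × { u : ℕ → ℝ // Monotone u ∧ ∀ i, u i ∈ Icc s t } =>
    ∑ i ∈ Finset.range w.1, (edist (x (w.2.1 (i + 1))) (x (w.2.1 i))) ^ q)
    (w.1, ⟨w.2.1, w.2.2.1, fun i => Icc_subset_Icc hs ht (w.2.2.2 i)⟩)

theorem edist_rpow_le_powVar (q : ℝ) (x : ℝ → E) {a b : ℝ} (hab : a ≤ b) :
    edist (x b) (x a) ^ q ≤ powVar q x a b := by
  have hm : Monotone (fun i : ℕ => if i = 0 then a else b) := by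
    intro i j hij
    by_cases hi : i = 0
    · by_cases hj : j = 0 <;> simp [hi, hj, hab]
    · have hj : j ≠ 0 := by omega
      simp [hi, hj]
  have := le_iSup (fun w : ℕ × { u : ℕ → ℝ // Monotone u ∧ ∀ i, u i ∈ Icc a b } =>
    ∑ i ∈ Finset.range w.1, (edist (x (w.2.1 (i + 1))) (x (w.2.1 i))) ^ q)
    (1, ⟨fun i : ℕ => if i = 0 then a else b, hm, fun i => by by_cases hi : i = 0 <;> simp [hi, hab]⟩)
  simpa [powVar] using this

theorem powVar_superadd (q : ℝ) (x : ℝ → E) {a b c : ℝ} (hab : a ≤ b) (hbc : b ≤ c) :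
    powVar q x a b + powVar q x b c ≤ powVar q x a c := by
  have : Nonempty { u : ℕ → ℝ // Monotone u ∧ ∀ i, u i ∈ Icc a b } :=
    ⟨⟨fun _ => a, monotone_const, fun _ => ⟨le_rfl, hab⟩⟩⟩
  have : Nonempty { u : ℕ → ℝ // Monotone u ∧ ∀ i, u i ∈ Icc b c } :=
    ⟨⟨fun _ => b, monotone_const, fun _ => ⟨le_rfl, hbc⟩⟩⟩
  refine ENNReal.iSup_add_iSup_le fun w w' => ?_
  obtain ⟨n, u, hu, hu'⟩ := w
  obtain ⟨m, v, hv, hv'⟩ := w'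
  -- The two families are concatenated with `v` starting at index `n + 1`. Since `u n` need not be
  -- `b`, the sum for `g` has one extra term, from `u n` to `v 0`, which is nonnegative and is
  -- dropped.
  set g : ℕ → ℝ := fun i => if i ≤ n then u i else v (i - (n + 1)) with hg
  have hgm : Monotone g := by
    intro i j hij
    simp only [hg]
    split_ifs with h1 h2 h2
    · exact hu hij
    · exact (hu' i).2.trans (hv' _).1
    · omega
    · exact hv (by omega)
  have hgI : ∀ i, g i ∈ Icc a c := by
    intro i
    simp only [hg]
    split_ifs
    · exact Icc_subset_Icc le_rfl hbc (hu' i)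
    · exact Icc_subset_Icc hab le_rfl (hv' _)
  refine le_trans ?_ (le_iSup (fun w : ℕ × { u : ℕ → ℝ // Monotone u ∧ ∀ i, u i ∈ Icc a c } =>
    ∑ i ∈ Finset.range w.1, (edist (x (w.2.1 (i + 1))) (x (w.2.1 i))) ^ q)
    (n + 1 + m, ⟨g, hgm, hgI⟩))
  simp only
  rw [Finset.sum_range_add, Finset.sum_range_succ]
  refine add_le_add (le_add_right (Finset.sum_le_sum fun i hi => ?_))
    (Finset.sum_le_sum fun i _ => ?_)
  · have hi' := Finset.mem_range.1 hi
    simp only [hg, if_pos (show i ≤ n by omega), if_pos (show i + 1 ≤ n by omega)]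
    exact le_rfl
  · simp only [hg, if_neg (show ¬ n + 1 + i ≤ n by omega),
      if_neg (show ¬ n + 1 + i + 1 ≤ n by omega)]
    rw [show n + 1 + i + 1 - (n + 1) = i + 1 by omega, show n + 1 + i - (n + 1) = i by omega]

/-- The variation is the smallest control dominating the increments. -/
theorem powVar_le_of_control {q : ℝ} (hq : 0 ≤ q) {x : ℝ → E} {ω : ℝ → ℝ → ℝ} {s t : ℝ}
    (hω : IsControl ω s t)
    (h : ∀ a b, s ≤ a → a ≤ b → b ≤ t → ‖x b - x a‖ ^ q ≤ ω a b) :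
    powVar q x s t ≤ ENNReal.ofReal (ω s t) := by
  refine iSup_le fun w => ?_
  obtain ⟨n, u, hu, hu'⟩ := w
  simp only
  calc ∑ i ∈ Finset.range n, edist (x (u (i + 1))) (x (u i)) ^ q
      ≤ ∑ i ∈ Finset.range n, ENNReal.ofReal (ω (u i) (u (i + 1))) := by
        refine Finset.sum_le_sum fun i _ => ?_
        rw [edist_dist, dist_eq_norm, ENNReal.ofReal_rpow_of_nonneg (norm_nonneg _) hq]
        exact ENNReal.ofReal_le_ofReal (h _ _ (hu' i).1 (hu i.le_succ) (hu' (i + 1)).2)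
    _ = ENNReal.ofReal (∑ i ∈ Finset.range n, ω (u i) (u (i + 1))) :=
        (ENNReal.ofReal_sum_of_nonneg fun i _ =>
          hω.nonneg _ _ (hu' i).1 (hu i.le_succ) (hu' (i + 1)).2).symm
    _ ≤ ENNReal.ofReal (ω s t) := by
        refine ENNReal.ofReal_le_ofReal ?_
        obtain ⟨h1, h2⟩ := hω.sum_le n (fun i _ => hu i.le_succ) (hu' 0).1 (hu' n).2
        exact h2.trans (hω.mono le_rfl (hu' 0).1 h1 (hu' n).2 le_rfl)

/-- The `q`-th power of the `q`-variation, as a real number. -/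
noncomputable def varControl (q : ℝ) (x : ℝ → E) (a b : ℝ) : ℝ := (powVar q x a b).toReal

theorem varControl_nonneg (q : ℝ) (x : ℝ → E) (a b : ℝ) : 0 ≤ varControl q x a b :=
  ENNReal.toReal_nonneg

theorem isControl_varControl {q : ℝ} {x : ℝ → E} {s t : ℝ} (h : powVar q x s t ≠ ∞) :
    IsControl (varControl q x) s t := by
  refine ⟨fun a b _ _ _ => varControl_nonneg q x a b, fun a b c h1 h2 h3 h4 => ?_⟩
  have hac : powVar q x a c ≠ ∞ := ne_top_of_le_ne_top h (powVar_mono q x h1 h4)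
  have hab : powVar q x a b ≠ ∞ := ne_top_of_le_ne_top hac (powVar_mono q x le_rfl h3)
  have hbc : powVar q x b c ≠ ∞ := ne_top_of_le_ne_top hac (powVar_mono q x h2 le_rfl)
  unfold varControl
  rw [← ENNReal.toReal_add hab hbc]
  exact ENNReal.toReal_mono hac (powVar_superadd q x h2 h3)

theorem norm_rpow_le_varControl {q : ℝ} {x : ℝ → E} {s t : ℝ}
    (h : powVar q x s t ≠ ∞) {a b : ℝ} (ha : s ≤ a) (hab : a ≤ b) (hb : b ≤ t) :
    ‖x b - x a‖ ^ q ≤ varControl q x a b := by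
  have h1 : powVar q x a b ≠ ∞ := ne_top_of_le_ne_top h (powVar_mono q x ha hb)
  have h2 := ENNReal.toReal_mono h1 (edist_rpow_le_powVar q x hab)
  rwa [← ENNReal.toReal_rpow, edist_dist, ENNReal.toReal_ofReal dist_nonneg, dist_eq_norm] at h2

theorem norm_le_varControl_rpow {q : ℝ} (hq : 0 < q) {x : ℝ → E} {s t : ℝ}
    (h : powVar q x s t ≠ ∞) {a b : ℝ} (ha : s ≤ a) (hab : a ≤ b) (hb : b ≤ t) :
    ‖x b - x a‖ ≤ varControl q x a b ^ (1 / q) := by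
  have h1 := Real.rpow_le_rpow (by positivity) (norm_rpow_le_varControl h ha hab hb)
    (by positivity : 0 ≤ 1 / q)
  rwa [← Real.rpow_mul (norm_nonneg _), mul_one_div_cancel hq.ne', Real.rpow_one] at h1

theorem varControl_le_of_control {q : ℝ} (hq : 0 ≤ q) {x : ℝ → E} {ω : ℝ → ℝ → ℝ} {s t : ℝ}
    (hst : s ≤ t) (hω : IsControl ω s t)
    (h : ∀ a b, s ≤ a → a ≤ b → b ≤ t → ‖x b - x a‖ ^ q ≤ ω a b) :
    varControl q x s t ≤ ω s t :=
  ENNReal.toReal_le_of_le_ofReal (hω.nonneg _ _ le_rfl hst le_rfl)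
    (powVar_le_of_control hq hω h)

theorem powVar_ne_top_of_control {q : ℝ} (hq : 0 ≤ q) {x : ℝ → E} {ω : ℝ → ℝ → ℝ} {s t : ℝ}
    (hω : IsControl ω s t)
    (h : ∀ a b, s ≤ a → a ≤ b → b ≤ t → ‖x b - x a‖ ^ q ≤ ω a b) :
    powVar q x s t ≠ ∞ :=
  ne_top_of_le_ne_top ENNReal.ofReal_ne_top (powVar_le_of_control hq hω h)

end PowVar

/-! ### Young's inequality for Riemann sums -/

section YoungSum

variable {F G : Type*} [NormedAddCommGroup F] [NormedSpace ℝ F]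
    [NormedAddCommGroup G] [NormedSpace ℝ G]

/-- Averaging: the `m + 1` numbers `a i / A + b i / B` have sum at most 2, so one of them is at most
`2 / (m + 1)`, and both of its summands are then small at once. -/
theorem exists_two_mul_div_bound {a b : ℕ → ℝ} {A B : ℝ} {m : ℕ}
    (ha : ∀ i ≤ m, 0 ≤ a i) (hb : ∀ i ≤ m, 0 ≤ b i)
    (hA : ∑ i ∈ Finset.range (m + 1), a i ≤ A) (hB : ∑ i ∈ Finset.range (m + 1), b i ≤ B) :
    ∃ i ≤ m, a i ≤ 2 / ((m : ℝ) + 1) * A ∧ b i ≤ 2 / ((m : ℝ) + 1) * B := by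
  have hm : (0 : ℝ) < (m : ℝ) + 1 := by positivity
  have ha' : ∀ i ∈ Finset.range (m + 1), 0 ≤ a i := fun i hi =>
    ha i (Nat.lt_succ_iff.1 (Finset.mem_range.1 hi))
  have hb' : ∀ i ∈ Finset.range (m + 1), 0 ≤ b i := fun i hi =>
    hb i (Nat.lt_succ_iff.1 (Finset.mem_range.1 hi))
  have hA0 : 0 ≤ A := (Finset.sum_nonneg ha').trans hA
  have hB0 : 0 ≤ B := (Finset.sum_nonneg hb').trans hB
  obtain ⟨i, hi, hle⟩ : ∃ i ∈ Finset.range (m + 1), a i / A + b i / B ≤ 2 / ((m : ℝ) + 1) := by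
    refine Finset.exists_le_of_sum_le (by simp) ?_
    rw [Finset.sum_add_distrib, ← Finset.sum_div, ← Finset.sum_div, Finset.sum_const,
      Finset.card_range, nsmul_eq_mul]
    push_cast
    rw [mul_div_cancel₀ _ hm.ne']
    linarith [div_le_one_of_le₀ hA hA0, div_le_one_of_le₀ hB hB0]
  refine ⟨i, Nat.lt_succ_iff.1 (Finset.mem_range.1 hi), ?_, ?_⟩
  -- If `A = 0`, division by `A` carries no information, but then every `a i` vanishes.
  · rcases hA0.eq_or_lt with h | h
    · have := (Finset.single_le_sum ha' hi).trans hA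
      rw [← h] at this ⊢
      simpa using this
    · rw [← div_le_iff₀ h]
      linarith [div_nonneg (hb' i hi) hB0]
  · rcases hB0.eq_or_lt with h | h
    · have := (Finset.single_le_sum hb' hi).trans hB
      rw [← h] at this ⊢
      simpa using this
    · rw [← div_le_iff₀ h]
      linarith [div_nonneg (ha' i hi) hA0]

/-- The left Riemann sum of `y dz` along the first `n` intervals of `τ`. -/
noncomputable def leftSum (y : ℝ → F →L[ℝ] G) (z : ℝ → F) (n : ℕ) (τ : ℕ → ℝ) : G :=
  ∑ i ∈ Finset.range n, y (τ i) (z (τ (i + 1)) - z (τ i))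

/-- Deleting the point `τ (i + 1)` merges two intervals, and the sum changes by a product of
consecutive increments only. -/
theorem leftSum_erase (y : ℝ → F →L[ℝ] G) (z : ℝ → F) (τ : ℕ → ℝ) (i l : ℕ) :
    leftSum y z (i + l + 2) τ
      = leftSum y z (i + l + 1) (fun j => if j ≤ i then τ j else τ (j + 1))
        + (y (τ (i + 1)) - y (τ i)) (z (τ (i + 2)) - z (τ (i + 1))) := by
  unfold leftSum
  rw [show i + l + 2 = i + 1 + 1 + l by ring, show i + l + 1 = i + 1 + l by ring,
    Finset.sum_range_add _ (i + 1 + 1), Finset.sum_range_add _ (i + 1) l,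
    Finset.sum_range_succ _ (i + 1), Finset.sum_range_succ _ i, Finset.sum_range_succ _ i]
  have h1 : ∀ j ∈ Finset.range i, y (τ j) (z (τ (j + 1)) - z (τ j)) =
      y (if j ≤ i then τ j else τ (j + 1)) (z (if j + 1 ≤ i then τ (j + 1) else τ (j + 1 + 1))
        - z (if j ≤ i then τ j else τ (j + 1))) := by
    intro j hj
    have := Finset.mem_range.1 hj
    rw [if_pos (by omega), if_pos (by omega)]
  have h2 : ∀ j ∈ Finset.range l,
      y (τ (i + 1 + 1 + j)) (z (τ (i + 1 + 1 + j + 1)) - z (τ (i + 1 + 1 + j))) =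
      y (if i + 1 + j ≤ i then τ (i + 1 + j) else τ (i + 1 + j + 1))
        (z (if i + 1 + j + 1 ≤ i then τ (i + 1 + j + 1) else τ (i + 1 + j + 1 + 1))
        - z (if i + 1 + j ≤ i then τ (i + 1 + j) else τ (i + 1 + j + 1))) := by
    intro j _
    rw [if_neg (by omega), if_neg (by omega), show i + 1 + 1 + j = i + 1 + j + 1 by ring]
  beta_reduce
  rw [Finset.sum_congr rfl h1, Finset.sum_congr rfl h2, if_pos le_rfl, if_neg (by omega)]
  simp only [sub_apply, map_sub]
  abel

/-- The constant of Young's inequality. -/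
noncomputable def youngConst (θ : ℝ) : ℝ := ∑' k : ℕ, (2 / ((k : ℝ) + 1)) ^ θ

theorem summable_youngConst {θ : ℝ} (hθ : 1 < θ) :
    Summable fun k : ℕ => (2 / ((k : ℝ) + 1)) ^ θ := by
  have h := ((summable_nat_add_iff 1).2 (Real.summable_one_div_nat_rpow.2 hθ)).mul_left (2 ^ θ)
  refine h.congr fun k => ?_
  rw [Real.div_rpow (by norm_num) (by positivity)]
  push_cast
  ring

theorem youngConst_nonneg (θ : ℝ) : 0 ≤ youngConst θ :=
  tsum_nonneg fun k => by positivity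

/-- Young's argument: interior points are deleted one by one until only `y s (z t - z s)` is left.
With `m + 1` interior points present, the best choice costs at most `(2 / (m + 1)) ^ (α + β)` times
the product of the controls. -/
theorem norm_leftSum_sub_le_sum {α β : ℝ} (hα : 0 < α) (hβ : 0 < β)
    {ω₁ ω₂ : ℝ → ℝ → ℝ} {s t : ℝ} (h₁ : IsControl ω₁ s t) (h₂ : IsControl ω₂ s t)
    {y : ℝ → F →L[ℝ] G} {z : ℝ → F}
    (hy : ∀ a b, s ≤ a → a ≤ b → b ≤ t → ‖y b - y a‖ ≤ ω₁ a b ^ α)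
    (hz : ∀ a b, s ≤ a → a ≤ b → b ≤ t → ‖z b - z a‖ ≤ ω₂ a b ^ β)
    (n : ℕ) (τ : ℕ → ℝ) (hτ : IsDissection (n + 1) τ s t) :
    ‖leftSum y z (n + 1) τ - y s (z t - z s)‖ ≤
      (∑ k ∈ Finset.range n, (2 / ((k : ℝ) + 1)) ^ (α + β)) * (ω₁ s t ^ α * ω₂ s t ^ β) := by
  induction n generalizing τ with
  | zero =>
    have h1 := hτ.left
    have h2 := hτ.right
    simp only [zero_add] at h2
    simp [leftSum, h1, h2]
  | succ m ih =>
    have hmem : ∀ i ≤ m + 2, τ i ∈ Icc s t := fun i hi => hτ.mem_Icc hi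
    have hmono : ∀ i ≤ m + 1, τ i ≤ τ (i + 1) := fun i hi => hτ.mono i (by omega)
    -- The interior point `τ (i + 1)` is weighed by `ω₁` on the interval to its left, which carries
    -- the increment of `y`, and by `ω₂` on the interval to its right, which carries that of `z`.
    have hA : ∑ i ∈ Finset.range (m + 1), ω₁ (τ i) (τ (i + 1)) ≤ ω₁ s t := by
      obtain ⟨h3, h4⟩ := h₁.sum_le (m + 1) (fun i hi => hmono i (by omega)) (hmem 0 (by omega)).1
        (hmem (m + 1) (by omega)).2
      exact h4.trans (h₁.mono le_rfl (hmem 0 (by omega)).1 h3 (hmem (m + 1) (by omega)).2 le_rfl)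
    have hB : ∑ i ∈ Finset.range (m + 1), ω₂ (τ (i + 1)) (τ (i + 2)) ≤ ω₂ s t := by
      obtain ⟨h3, h4⟩ := h₂.sum_le (τ := fun i => τ (i + 1)) (m + 1)
        (fun i hi => hmono (i + 1) (by omega)) (hmem 1 (by omega)).1 (hmem (m + 2) (by omega)).2
      exact h4.trans (h₂.mono le_rfl (hmem 1 (by omega)).1 h3 (hmem (m + 2) (by omega)).2 le_rfl)
    have hst : s ≤ t := (hmem 0 (by omega)).1.trans (hmem 0 (by omega)).2
    have hA0 := h₁.nonneg s t le_rfl hst le_rfl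
    have hB0 := h₂.nonneg s t le_rfl hst le_rfl
    have ha : ∀ i ≤ m, 0 ≤ ω₁ (τ i) (τ (i + 1)) := fun i hi =>
      h₁.nonneg _ _ (hmem i (by omega)).1 (hmono i (by omega)) (hmem (i + 1) (by omega)).2
    have hb : ∀ i ≤ m, 0 ≤ ω₂ (τ (i + 1)) (τ (i + 2)) := fun i hi =>
      h₂.nonneg _ _ (hmem (i + 1) (by omega)).1 (hmono (i + 1) (by omega))
        (hmem (i + 2) (by omega)).2
    obtain ⟨i, hi, hi1, hi2⟩ := exists_two_mul_div_bound ha hb hA hB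
    obtain ⟨l, rfl⟩ := Nat.exists_eq_add_of_le hi
    set τ' : ℕ → ℝ := fun j => if j ≤ i then τ j else τ (j + 1) with hτ'
    have hd : IsDissection (i + l + 1) τ' s t := by
      refine ⟨?_, ?_, fun j hj => ?_⟩
      · simp [hτ', hτ.left]
      · simp only [hτ']
        rw [if_neg (by omega)]
        exact hτ.right
      · simp only [hτ']
        split_ifs
        · exact hmono j (by omega)
        · exact (hmono j (by omega)).trans (hmono (j + 1) (by omega))
        · omega
        · exact hmono (j + 1) (by omega)
    have hih := ih τ' hd
    have hrem : ‖(y (τ (i + 1)) - y (τ i)) (z (τ (i + 2)) - z (τ (i + 1)))‖ ≤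
        (2 / (((i + l : ℕ) : ℝ) + 1)) ^ (α + β) * (ω₁ s t ^ α * ω₂ s t ^ β) := by
      have e1 := (hy _ _ (hmem i (by omega)).1 (hmono i (by omega)) (hmem (i + 1) (by omega)).2).trans
        (Real.rpow_le_rpow (ha i hi) hi1 hα.le)
      have e2 := (hz _ _ (hmem (i + 1) (by omega)).1 (hmono (i + 1) (by omega))
        (hmem (i + 2) (by omega)).2).trans (Real.rpow_le_rpow (hb i hi) hi2 hβ.le)
      refine (ContinuousLinearMap.le_opNorm _ _).trans
        ((mul_le_mul e1 e2 (norm_nonneg _) (by positivity)).trans (le_of_eq ?_))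
      have hc : (0 : ℝ) < 2 / (((i + l : ℕ) : ℝ) + 1) := by positivity
      rw [Real.mul_rpow hc.le hA0, Real.mul_rpow hc.le hB0, Real.rpow_add hc]
      ring
    rw [Finset.sum_range_succ, add_mul]
    have hsplit := leftSum_erase y z τ i l
    rw [show i + l + 1 + 1 = i + l + 2 by ring, hsplit, add_sub_right_comm]
    exact (norm_add_le _ _).trans (add_le_add hih hrem)

/-- Young's inequality for Riemann sums. -/
theorem norm_leftSum_sub_le {α β : ℝ} (hα : 0 < α) (hβ : 0 < β) (hαβ : 1 < α + β)
    {ω₁ ω₂ : ℝ → ℝ → ℝ} {s t : ℝ} (h₁ : IsControl ω₁ s t) (h₂ : IsControl ω₂ s t)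
    {y : ℝ → F →L[ℝ] G} {z : ℝ → F}
    (hy : ∀ a b, s ≤ a → a ≤ b → b ≤ t → ‖y b - y a‖ ≤ ω₁ a b ^ α)
    (hz : ∀ a b, s ≤ a → a ≤ b → b ≤ t → ‖z b - z a‖ ≤ ω₂ a b ^ β)
    {n : ℕ} {τ : ℕ → ℝ} (hτ : IsDissection n τ s t) :
    ‖leftSum y z n τ - y s (z t - z s)‖ ≤
      youngConst (α + β) * (ω₁ s t ^ α * ω₂ s t ^ β) := by
  have hst : s ≤ t := (hτ.mem_Icc (Nat.zero_le n)).1.trans (hτ.mem_Icc (Nat.zero_le n)).2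
  have hP : 0 ≤ ω₁ s t ^ α * ω₂ s t ^ β :=
    mul_nonneg (Real.rpow_nonneg (h₁.nonneg s t le_rfl hst le_rfl) _)
      (Real.rpow_nonneg (h₂.nonneg s t le_rfl hst le_rfl) _)
  cases n with
  | zero =>
    have h1 := hτ.left
    have h2 := hτ.right
    have : s = t := h1.symm.trans h2
    subst this
    simpa [leftSum] using mul_nonneg (youngConst_nonneg (α + β)) hP
  | succ n =>
    refine (norm_leftSum_sub_le_sum hα hβ h₁ h₂ hy hz n τ hτ).trans
      (mul_le_mul_of_nonneg_right ?_ hP)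
    exact (summable_youngConst hαβ).sum_le_tsum _ fun k _ => by positivity

end YoungSum

end Sweeping

namespace Sweeping

/-! ### Change of exponent and smallness on short intervals -/

section Exponents

variable {E : Type*} [NormedAddCommGroup E]

theorem add_rpow_le_mul_rpow_add_rpow {x y q : ℝ} (hx : 0 ≤ x) (hy : 0 ≤ y) (hq : 1 ≤ q) :
    (x + y) ^ q ≤ 2 ^ (q - 1) * (x ^ q + y ^ q) := by
  lift x to NNReal using hx
  lift y to NNReal using hy
  exact_mod_cast NNReal.rpow_add_le_mul_rpow_add_rpow x y hq

theorem exists_pos_rpow_mul_lt {σ V ε : ℝ} (hσ : 0 < σ) (hV : 0 ≤ V) (hε : 0 < ε) :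
    ∃ η > 0, η ^ σ * V < ε := by
  have hpos : 0 < ε / (V + 1) := by positivity
  -- With this `η`, `η ^ σ * V = ε * V / (V + 1) < ε`; the added 1 covers `V = 0`.
  refine ⟨(ε / (V + 1)) ^ (1 / σ), by positivity, ?_⟩
  rw [← Real.rpow_mul hpos.le, one_div_mul_cancel hσ.ne', Real.rpow_one, div_mul_eq_mul_div,
    div_lt_iff₀ (by positivity)]
  nlinarith

theorem rpow_le_rpow_sub_mul {p q x η : ℝ} (hp : 0 < p) (hpq : p ≤ q) (hx : 0 ≤ x) (hxη : x ≤ η) :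
    x ^ q ≤ η ^ (q - p) * x ^ p := by
  have h : x ^ q = x ^ (q - p) * x ^ p := by
    rw [← Real.rpow_add_of_nonneg hx (by linarith) hp.le]
    ring_nf
  rw [h]
  exact mul_le_mul_of_nonneg_right (Real.rpow_le_rpow hx hxη (by linarith)) (by positivity)

/-- Interpolation: `|x|^q ≤ η^(q-p) |x|^p` for increments bounded by `η`. The surplus exponent `q -
p` turns small oscillation into small `q`-variation. -/
theorem powVar_le_of_osc_le {p q η : ℝ} (hp : 0 < p) (hpq : p ≤ q) {x : ℝ → E} {s t : ℝ}
    (hη : 0 ≤ η) (h : powVar p x s t ≠ ∞)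
    (hosc : ∀ a b, s ≤ a → a ≤ b → b ≤ t → ‖x b - x a‖ ≤ η) :
    powVar q x s t ≤ ENNReal.ofReal (η ^ (q - p) * varControl p x s t) :=
  powVar_le_of_control (hp.le.trans hpq)
    ((isControl_varControl h).const_mul (Real.rpow_nonneg hη _)) fun a b ha hab hb =>
    (rpow_le_rpow_sub_mul hp hpq (norm_nonneg _) (hosc a b ha hab hb)).trans
      (mul_le_mul_of_nonneg_left (norm_rpow_le_varControl h ha hab hb) (Real.rpow_nonneg hη _))

theorem powVar_ne_top_of_le {p q : ℝ} (hp : 0 < p) (hpq : p ≤ q) {x : ℝ → E} {s t : ℝ}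
    (h : powVar p x s t ≠ ∞) : powVar q x s t ≠ ∞ := by
  refine ne_top_of_le_ne_top ENNReal.ofReal_ne_top
    (powVar_le_of_osc_le (η := varControl p x s t ^ (1 / p)) hp hpq
      (Real.rpow_nonneg (varControl_nonneg _ _ _ _) _) h fun a b ha hab hb => ?_)
  refine (norm_le_varControl_rpow hp h ha hab hb).trans
    (Real.rpow_le_rpow (varControl_nonneg _ _ _ _) ?_ (by positivity))
  exact (isControl_varControl h).mono le_rfl ha hab hb le_rfl

theorem _root_.ContinuousOn.exists_norm_sub_lt_of_Icc {x : ℝ → E} {s t : ℝ}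
    (hx : ContinuousOn x (Icc s t)) {ε : ℝ} (hε : 0 < ε) :
    ∃ δ > 0, ∀ a b, s ≤ a → a ≤ b → b ≤ t → b - a < δ → ‖x b - x a‖ < ε := by
  obtain ⟨δ, hδ, h⟩ := Metric.uniformContinuousOn_iff.1
    (isCompact_Icc.uniformContinuousOn_of_continuous hx) ε hε
  refine ⟨δ, hδ, fun a b ha hab hb hd => ?_⟩
  rw [← dist_eq_norm]
  refine h b ⟨ha.trans hab, hb⟩ a ⟨ha, hab.trans hb⟩ ?_
  rwa [Real.dist_eq, abs_of_nonneg (by linarith)]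

/-- For a continuous path of finite `p`-variation, the `q`-variation on short intervals is small
when `p < q`. -/
theorem exists_varControl_lt {p q : ℝ} (hp : 0 < p) (hpq : p < q) {x : ℝ → E} {s t : ℝ}
    (hx : ContinuousOn x (Icc s t)) (h : powVar p x s t ≠ ∞) {ε : ℝ} (hε : 0 < ε) :
    ∃ δ > 0, ∀ a b, s ≤ a → a ≤ b → b ≤ t → b - a < δ → varControl q x a b < ε := by
  obtain ⟨η, hη, hηε⟩ := exists_pos_rpow_mul_lt (sub_pos.2 hpq) (varControl_nonneg p x s t) hε
  obtain ⟨δ, hδ, hd⟩ := hx.exists_norm_sub_lt_of_Icc hη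
  refine ⟨δ, hδ, fun a b ha hab hb hlt => lt_of_le_of_lt ?_ hηε⟩
  have hV := (isControl_varControl h).mono le_rfl ha hab hb le_rfl
  refine le_trans ?_ (mul_le_mul_of_nonneg_left hV (by positivity))
  exact ENNReal.toReal_le_of_le_ofReal
    (mul_nonneg (by positivity) (varControl_nonneg _ _ _ _))
    (powVar_le_of_osc_le hp hpq.le hη.le
      (ne_top_of_le_ne_top h (powVar_mono p x ha hb)) fun c d hc hcd hdb =>
      (hd c d (ha.trans hc) hcd (hdb.trans hb) (by linarith)).le)

theorem powVar_one_ne_top_of_boundedVariationOn {x : ℝ → E} {s t : ℝ}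
    (h : BoundedVariationOn x (Icc s t)) : powVar 1 x s t ≠ ∞ := by
  refine ne_top_of_le_ne_top h (iSup_le fun w => ?_)
  simp only [ENNReal.rpow_one]
  exact eVariationOn.sum_le w.2.2.1 w.2.2.2

theorem powVar_add_ne_top {q : ℝ} (hq : 1 ≤ q) {x x' : ℝ → E} {s t : ℝ}
    (h : powVar q x s t ≠ ∞) (h' : powVar q x' s t ≠ ∞) :
    powVar q (fun u => x u + x' u) s t ≠ ∞ := by
  refine powVar_ne_top_of_control (by linarith)
    (((isControl_varControl h).add (isControl_varControl h')).const_mul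
      (by positivity : (0 : ℝ) ≤ 2 ^ (q - 1))) fun a b ha hab hb => ?_
  have e : x b + x' b - (x a + x' a) = (x b - x a) + (x' b - x' a) := by abel
  rw [e]
  refine (Real.rpow_le_rpow (norm_nonneg _) (norm_add_le _ _) (by linarith)).trans
    ((add_rpow_le_mul_rpow_add_rpow (norm_nonneg _) (norm_nonneg _) hq).trans ?_)
  gcongr
  · exact norm_rpow_le_varControl h ha hab hb
  · exact norm_rpow_le_varControl h' ha hab hb

theorem powVar_congr {q : ℝ} {x x' : ℝ → E} {s t : ℝ} (h : EqOn x x' (Icc s t)) :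
    powVar q x s t = powVar q x' s t := by
  unfold powVar
  refine iSup_congr fun w => Finset.sum_congr rfl fun i _ => ?_
  rw [h (w.2.2.2 _), h (w.2.2.2 _)]

theorem powVar_neg (q : ℝ) (x : ℝ → E) (s t : ℝ) :
    powVar q (fun u => -x u) s t = powVar q x s t := by
  unfold powVar
  simp only [edist_neg_neg]

theorem powVar_sub_ne_top {q : ℝ} (hq : 1 ≤ q) {x x' : ℝ → E} {s t : ℝ}
    (h : powVar q x s t ≠ ∞) (h' : powVar q x' s t ≠ ∞) :
    powVar q (fun u => x u - x' u) s t ≠ ∞ := by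
  simp only [sub_eq_add_neg]
  exact powVar_add_ne_top hq h (by rwa [powVar_neg])

end Exponents

/-! ### Young integrals: subintervals, linearity, bounds -/

section Integral

variable {F G : Type*} [NormedAddCommGroup F] [NormedSpace ℝ F]
    [NormedAddCommGroup G] [NormedSpace ℝ G]

theorem exists_isDissection_mesh_lt {s t δ : ℝ} (hst : s ≤ t) (hδ : 0 < δ) :
    ∃ (n : ℕ) (τ : ℕ → ℝ), IsDissection n τ s t ∧ ∀ i < n, τ (i + 1) - τ i < δ := by
  obtain ⟨n, hn⟩ := exists_nat_gt ((t - s) / δ)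
  have hn1 : (0 : ℝ) < (n : ℝ) + 1 := by positivity
  have hstep : ∀ i : ℕ, s + (t - s) * ((i + 1 : ℕ) : ℝ) / ((n : ℝ) + 1)
      - (s + (t - s) * (i : ℝ) / ((n : ℝ) + 1)) = (t - s) / ((n : ℝ) + 1) := by
    intro i
    push_cast
    field_simp
    ring
  refine ⟨n + 1, fun i => s + (t - s) * (i : ℝ) / ((n : ℝ) + 1), ⟨by simp, ?_, fun i _ => ?_⟩,
    fun i _ => ?_⟩
  · push_cast
    field_simp
    ring
  · have h1 : 0 ≤ (t - s) / ((n : ℝ) + 1) := div_nonneg (by linarith) hn1.le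
    linarith [hstep i]
  · beta_reduce
    rw [hstep i, div_lt_iff₀ hn1]
    rw [div_lt_iff₀ hδ] at hn
    nlinarith

theorem IsDissection.append {n m : ℕ} {τ σ : ℕ → ℝ} {a b c : ℝ} (h : IsDissection n τ a b)
    (h' : IsDissection m σ b c) :
    IsDissection (n + m) (fun i => if i ≤ n then τ i else σ (i - n)) a c ∧
      ∀ j, (fun i => if i ≤ n then τ i else σ (i - n)) (n + j) = σ j := by
  have key : ∀ j, (if n + j ≤ n then τ (n + j) else σ (n + j - n)) = σ j := by
    intro j
    split_ifs with hj
    · obtain rfl : j = 0 := by omega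
      rw [add_zero, h.right, h'.left]
    · rw [Nat.add_sub_cancel_left]
  refine ⟨⟨by simp [h.left], (key m).trans h'.right, fun i hi => ?_⟩, key⟩
  by_cases hin : i + 1 ≤ n
  · rw [if_pos hin, if_pos (by omega)]
    exact h.mono i hin
  · obtain ⟨j, rfl⟩ := Nat.exists_eq_add_of_le (show n ≤ i by omega)
    rw [key j, show n + j + 1 = n + (j + 1) by ring, key (j + 1)]
    exact h'.mono j (by omega)

/-- A dissection of `[b,c]` is completed by an auxiliary fine one of `[a,b]`, and the two Riemann
sums on `[a,c]` and `[a,b]` are subtracted. Convergence on `[b,c]` thus comes out as a conclusion.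
-/
theorem IsYoungIntegral.sub_interval {y : ℝ → F →L[ℝ] G} {z : ℝ → F} {a b c : ℝ} (hab : a ≤ b)
    {I J : G} (hI : IsYoungIntegral y z a b I) (hJ : IsYoungIntegral y z a c J) :
    IsYoungIntegral y z b c (J - I) := by
  intro ε hε
  obtain ⟨δ₁, hδ₁, h₁⟩ := hI (ε / 2) (by positivity)
  obtain ⟨δ₂, hδ₂, h₂⟩ := hJ (ε / 2) (by positivity)
  refine ⟨min δ₁ δ₂, lt_min hδ₁ hδ₂, fun m σ hσ hmesh => ?_⟩
  obtain ⟨n, τ, hτ, hτmesh⟩ := exists_isDissection_mesh_lt hab (lt_min hδ₁ hδ₂)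
  obtain ⟨hρ, hρσ⟩ := hτ.append hσ
  set ρ : ℕ → ℝ := fun i => if i ≤ n then τ i else σ (i - n) with hρdef
  have hρτ : ∀ i ≤ n, ρ i = τ i := fun i hi => if_pos hi
  have e1 := h₁ n τ hτ fun i hi => (hτmesh i hi).trans_le (min_le_left _ _)
  have e2 := h₂ (n + m) ρ hρ fun i hi => by
    by_cases hin : i + 1 ≤ n
    · rw [hρτ _ hin, hρτ _ (by omega)]
      exact (hτmesh i hin).trans_le (min_le_right _ _)
    · obtain ⟨j, rfl⟩ := Nat.exists_eq_add_of_le (show n ≤ i by omega)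
      rw [add_assoc, hρσ, hρσ]
      exact (hmesh j (by omega)).trans_le (min_le_right _ _)
  rw [Finset.sum_range_add] at e2
  have e3 : ∑ i ∈ Finset.range n, y (ρ i) (z (ρ (i + 1)) - z (ρ i)) =
      ∑ i ∈ Finset.range n, y (τ i) (z (τ (i + 1)) - z (τ i)) :=
    Finset.sum_congr rfl fun i hi => by
      have := Finset.mem_range.1 hi
      rw [hρτ _ (by omega), hρτ _ (by omega)]
  have e4 : ∑ i ∈ Finset.range m, y (ρ (n + i)) (z (ρ (n + i + 1)) - z (ρ (n + i))) =
      ∑ i ∈ Finset.range m, y (σ i) (z (σ (i + 1)) - z (σ i)) :=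
    Finset.sum_congr rfl fun i _ => by rw [add_assoc, hρσ, hρσ]
  rw [e3, e4] at e2
  set A := ∑ i ∈ Finset.range n, y (τ i) (z (τ (i + 1)) - z (τ i))
  set B := ∑ i ∈ Finset.range m, y (σ i) (z (σ (i + 1)) - z (σ i))
  have : B - (J - I) = (A + B - J) - (A - I) := by abel
  rw [this]
  linarith [norm_sub_le (A + B - J) (A - I)]

theorem IsYoungIntegral.sub {y y' : ℝ → F →L[ℝ] G} {z : ℝ → F} {a b : ℝ} {I I' : G}
    (hI : IsYoungIntegral y z a b I) (hI' : IsYoungIntegral y' z a b I') :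
    IsYoungIntegral (fun u => y u - y' u) z a b (I - I') := by
  intro ε hε
  obtain ⟨δ₁, hδ₁, h₁⟩ := hI (ε / 2) (by positivity)
  obtain ⟨δ₂, hδ₂, h₂⟩ := hI' (ε / 2) (by positivity)
  refine ⟨min δ₁ δ₂, lt_min hδ₁ hδ₂, fun n τ hτ hmesh => ?_⟩
  have e1 := h₁ n τ hτ fun i hi => (hmesh i hi).trans_le (min_le_left _ _)
  have e2 := h₂ n τ hτ fun i hi => (hmesh i hi).trans_le (min_le_right _ _)
  simp only [sub_apply, Finset.sum_sub_distrib]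
  rw [sub_sub_sub_comm]
  linarith [norm_sub_le (∑ i ∈ Finset.range n, y (τ i) (z (τ (i + 1)) - z (τ i)) - I)
    (∑ i ∈ Finset.range n, y' (τ i) (z (τ (i + 1)) - z (τ i)) - I')]

theorem IsYoungIntegral.norm_sub_le_of_leftSum {y : ℝ → F →L[ℝ] G} {z : ℝ → F} {a b K : ℝ}
    (hab : a ≤ b) {I w : G} (hI : IsYoungIntegral y z a b I)
    (h : ∀ n τ, IsDissection n τ a b → ‖leftSum y z n τ - w‖ ≤ K) : ‖I - w‖ ≤ K := by
  refine le_of_forall_pos_le_add fun ε hε => ?_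
  obtain ⟨δ, hδ, hd⟩ := hI ε hε
  obtain ⟨n, τ, hτ, hmesh⟩ := exists_isDissection_mesh_lt hab hδ
  have e1 : ‖leftSum y z n τ - I‖ < ε := hd n τ hτ hmesh
  have e2 := h n τ hτ
  have e3 : I - w = (leftSum y z n τ - w) - (leftSum y z n τ - I) := by abel
  rw [e3]
  linarith [norm_sub_le (leftSum y z n τ - w) (leftSum y z n τ - I)]

/-- The increments of a Young integral are dominated by those of the integrator. -/
theorem norm_youngIntegral_le {r q : ℝ} (hr : 0 < r) (hq : 0 < q) (hrq : 1 < 1 / r + 1 / q)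
    {y : ℝ → F →L[ℝ] G} {z : ℝ → F} {s t M : ℝ}
    (hy : powVar r y s t ≠ ∞) (hz : powVar q z s t ≠ ∞) (hM : ∀ u ∈ Icc s t, ‖y u‖ ≤ M)
    {a b : ℝ} (ha : s ≤ a) (hab : a ≤ b) (hb : b ≤ t) {I : G} (hI : IsYoungIntegral y z a b I) :
    ‖I‖ ≤ (M + youngConst (1 / r + 1 / q) * varControl r y s t ^ (1 / r))
      * varControl q z a b ^ (1 / q) := by
  have h1 := hI.norm_sub_le_of_leftSum hab fun n τ hτ =>
    norm_leftSum_sub_le (by positivity : 0 < 1 / r) (by positivity : 0 < 1 / q) hrq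
      ((isControl_varControl hy).restrict ha hb) ((isControl_varControl hz).restrict ha hb)
      (fun c d hc hcd hd => norm_le_varControl_rpow hr hy (ha.trans hc) hcd (hd.trans hb))
      (fun c d hc hcd hd => norm_le_varControl_rpow hq hz (ha.trans hc) hcd (hd.trans hb)) hτ
  have h2 : ‖y a (z b - z a)‖ ≤ M * varControl q z a b ^ (1 / q) :=
    (ContinuousLinearMap.le_opNorm _ _).trans (mul_le_mul (hM a ⟨ha, hab.trans hb⟩)
      (norm_le_varControl_rpow hq hz ha hab hb) (norm_nonneg _)
      ((norm_nonneg _).trans (hM a ⟨ha, hab.trans hb⟩)))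
  have h3 : varControl r y a b ^ (1 / r) ≤ varControl r y s t ^ (1 / r) :=
    Real.rpow_le_rpow (varControl_nonneg _ _ _ _)
      ((isControl_varControl hy).mono le_rfl ha hab hb le_rfl) (by positivity)
  have h4 : youngConst (1 / r + 1 / q) *
      (varControl r y a b ^ (1 / r) * varControl q z a b ^ (1 / q)) ≤
      youngConst (1 / r + 1 / q) *
      (varControl r y s t ^ (1 / r) * varControl q z a b ^ (1 / q)) :=
    mul_le_mul_of_nonneg_left (mul_le_mul_of_nonneg_right h3
      (Real.rpow_nonneg (varControl_nonneg _ _ _ _) _)) (youngConst_nonneg _)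
  have h5 : I = (I - y a (z b - z a)) + y a (z b - z a) := by abel
  rw [h5]
  refine (norm_add_le _ _).trans ?_
  linarith

end Integral

end Sweeping

namespace Sweeping

/-! ### Stein regularity and differences of compositions -/

section Stein

variable {E G : Type*} [NormedAddCommGroup E] [NormedSpace ℝ E]
    [NormedAddCommGroup G] [NormedSpace ℝ G]

theorem exists_norm_fderiv_sub_le_of_bound {f : E → G} {M : ℝ} (hf : ContDiff ℝ 2 f)
    (hM : ∀ x, ‖iteratedFDeriv ℝ 2 f x‖ ≤ M) (x y : E) :
    ‖fderiv ℝ f y - fderiv ℝ f x‖ ≤ M * ‖y - x‖ := by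
  have hd : Differentiable ℝ (fderiv ℝ f) :=
    (hf.fderiv_right (m := 1) (by norm_num)).differentiable (by norm_num)
  refine Convex.norm_image_sub_le_of_norm_fderiv_le (𝕜 := ℝ) (s := univ)
    (fun z _ => hd z) (fun z _ => ?_) convex_univ (mem_univ x) (mem_univ y)
  rw [← norm_iteratedFDeriv_one, norm_iteratedFDeriv_fderiv]
  exact hM z

/-- A map which is Lipschitz of order greater than one in the sense of Stein is differentiable with
bounded and Hölder continuous derivative. -/
theorem IsLipStein.exists_holder_fderiv {p γ : ℝ} (hp1 : 1 ≤ p) (hp2 : p < 2) (hγ : p < γ)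
    {f : E → G} (hf : IsLipStein γ f) :
    ∃ α L N : ℝ, 0 < α ∧ α ≤ 1 ∧ p < 1 + α ∧ 0 ≤ L ∧ 0 ≤ N ∧ Differentiable ℝ f ∧
      (∀ x, ‖fderiv ℝ f x‖ ≤ L) ∧
      ∀ x y, ‖fderiv ℝ f y - fderiv ℝ f x‖ ≤ N * ‖y - x‖ ^ α := by
  have hceil : 2 ≤ ⌈γ⌉₊ := by
    have : 1 < ⌈γ⌉₊ := Nat.lt_ceil.2 (by push_cast; linarith)
    omega
  have hk : 1 ≤ strictFloor γ := by unfold strictFloor; omega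
  have hk' : (1 : WithTop ℕ∞) ≤ (strictFloor γ : WithTop ℕ∞) := by exact_mod_cast hk
  have hdiff : Differentiable ℝ f := hf.contDiff.differentiable (by
    intro h0
    rw [h0] at hk'
    simp at hk')
  obtain ⟨L, hL⟩ := hf.bounded 1 hk
  have hL' : ∀ x, ‖fderiv ℝ f x‖ ≤ L := fun x => by
    rw [← norm_iteratedFDeriv_one]; exact hL x
  have hL0 : 0 ≤ L := (norm_nonneg _).trans (hL' 0)
  -- Either `strictFloor γ = 1`, so `γ ≤ 2` and the Hölder exponent of the derivative is `α = γ -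
  -- 1`, or a bounded second derivative exists and `α = 1`. Both choices give `p < 1 + α`.
  rcases hk.eq_or_lt with h1 | h2
  · obtain ⟨K, hK⟩ := hf.holder
    have hγ2 : γ ≤ 2 := by
      have : ⌈γ⌉₊ ≤ 2 := by unfold strictFloor at h1; omega
      simpa using Nat.ceil_le.1 this
    rw [← h1] at hK
    simp only [Nat.cast_one] at hK
    refine ⟨γ - 1, L, |K|, by linarith, by linarith, by linarith, hL0, abs_nonneg K, hdiff, hL',
      fun x y => ?_⟩
    have hK' : ‖iteratedFDeriv ℝ 1 f y - iteratedFDeriv ℝ 1 f x‖ ≤ |K| * ‖y - x‖ ^ (γ - 1) :=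
      (hK x y).trans (mul_le_mul_of_nonneg_right (le_abs_self K) (by positivity))
    -- The Hölder bound concerns one-variable multilinear maps; evaluating at `v` transfers it to
    -- the operator norm.
    refine ContinuousLinearMap.opNorm_le_bound _ (by positivity) fun v => ?_
    have e : (fderiv ℝ f y - fderiv ℝ f x) v =
        (iteratedFDeriv ℝ 1 f y - iteratedFDeriv ℝ 1 f x) (fun _ => v) := by
      simp [iteratedFDeriv_one_apply]
    rw [e]
    refine (ContinuousMultilinearMap.le_opNorm _ _).trans ?_
    simpa using mul_le_mul_of_nonneg_right hK' (norm_nonneg v)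
  · obtain ⟨M, hM⟩ := hf.bounded 2 h2
    have h2' : (2 : WithTop ℕ∞) ≤ (strictFloor γ : WithTop ℕ∞) := by exact_mod_cast h2
    refine ⟨1, L, M, one_pos, le_rfl, by linarith, hL0, (norm_nonneg _).trans (hM 0), hdiff, hL',
      fun x y => ?_⟩
    rw [Real.rpow_one]
    exact exists_norm_fderiv_sub_le_of_bound (hf.contDiff.of_le h2') hM x y

theorem norm_sub_le_of_fderiv_bound {f : E → G} {L : ℝ} (hf : Differentiable ℝ f)
    (hL : ∀ x, ‖fderiv ℝ f x‖ ≤ L) (x y : E) : ‖f y - f x‖ ≤ L * ‖y - x‖ :=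
  Convex.norm_image_sub_le_of_norm_fderiv_le (𝕜 := ℝ) (s := univ)
    (fun z _ => hf z) (fun z _ => hL z) convex_univ (mem_univ x) (mem_univ y)

/-- Mean value inequality for `θ ↦ f (b' + θ (b - b')) - f (a' + θ (a - a'))`. Its derivative splits
into `Df` applied to the difference of the two directions, and a difference of `Df` at two points
applied to `a - a'`; those points lie within `‖b - a‖ + ‖b' - a'‖` of each other. -/
theorem norm_second_difference_le {f : E → G} {L N α : ℝ} (hα : 0 ≤ α) (hN : 0 ≤ N)
    (hf : Differentiable ℝ f) (hL : ∀ x, ‖fderiv ℝ f x‖ ≤ L)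
    (hHol : ∀ x y, ‖fderiv ℝ f y - fderiv ℝ f x‖ ≤ N * ‖y - x‖ ^ α) (a b a' b' : E) :
    ‖(f b - f b') - (f a - f a')‖ ≤
      L * ‖(b - b') - (a - a')‖ + N * (‖b - a‖ + ‖b' - a'‖) ^ α * ‖a - a'‖ := by
  have hline : ∀ (u u' : E) (θ : ℝ), HasDerivAt (fun θ : ℝ => f (u' + θ • (u - u')))
      (fderiv ℝ f (u' + θ • (u - u')) (u - u')) θ := by
    intro u u' θ
    have h1 : HasDerivAt (fun θ : ℝ => u' + θ • (u - u')) (u - u') θ := by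
      simpa using ((hasDerivAt_id θ).smul_const (u - u')).const_add u'
    exact (hf _).hasFDerivAt.comp_hasDerivAt θ h1
  have h := norm_image_sub_le_of_norm_deriv_le_segment_01'
    (f := fun θ : ℝ => f (b' + θ • (b - b')) - f (a' + θ • (a - a')))
    (C := L * ‖(b - b') - (a - a')‖ + N * (‖b - a‖ + ‖b' - a'‖) ^ α * ‖a - a'‖)
    (fun θ _ => ((hline b b' θ).sub (hline a a' θ)).hasDerivWithinAt) (fun θ hθ => ?_)
  · simp only [one_smul, zero_smul, add_zero, add_sub_cancel] at h
    rwa [sub_sub_sub_comm] at h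
  · set P := b' + θ • (b - b') with hP
    set Q := a' + θ • (a - a') with hQ
    have e : fderiv ℝ f P (b - b') - fderiv ℝ f Q (a - a') =
        fderiv ℝ f P ((b - b') - (a - a')) + (fderiv ℝ f P - fderiv ℝ f Q) (a - a') := by
      simp only [map_sub, sub_apply]
      abel
    have hPQ : ‖P - Q‖ ≤ ‖b - a‖ + ‖b' - a'‖ := by
      have e2 : P - Q = θ • (b - a) + (1 - θ) • (b' - a') := by
        rw [hP, hQ]; module
      rw [e2]
      refine (norm_add_le _ _).trans (add_le_add ?_ ?_)
      · rw [norm_smul, Real.norm_of_nonneg hθ.1]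
        exact mul_le_of_le_one_left (norm_nonneg _) hθ.2.le
      · rw [norm_smul, Real.norm_of_nonneg (by linarith [hθ.2])]
        exact mul_le_of_le_one_left (norm_nonneg _) (by linarith [hθ.1])
    rw [e]
    refine (norm_add_le _ _).trans (add_le_add ?_ ?_)
    · exact (ContinuousLinearMap.le_opNorm _ _).trans
        (mul_le_mul_of_nonneg_right (hL P) (norm_nonneg _))
    · refine (ContinuousLinearMap.le_opNorm _ _).trans
        (mul_le_mul_of_nonneg_right ((hHol Q P).trans ?_) (norm_nonneg _))
      exact mul_le_mul_of_nonneg_left (Real.rpow_le_rpow (norm_nonneg _) hPQ hα) hN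

/-- The variation of `f ∘ X - f ∘ X'` is linearly controlled by that of `X - X'`, when the two paths
have the same starting point. -/
theorem exists_varControl_comp_sub_le {f : E → G} {L N α q : ℝ} (hα : 0 < α) (hα1 : α ≤ 1)
    (hL0 : 0 ≤ L) (hN : 0 ≤ N) (hq : 1 ≤ q) (hf : Differentiable ℝ f)
    (hL : ∀ x, ‖fderiv ℝ f x‖ ≤ L)
    (hHol : ∀ x y, ‖fderiv ℝ f y - fderiv ℝ f x‖ ≤ N * ‖y - x‖ ^ α) {X X' : ℝ → E} {S T : ℝ}
    (hX : powVar q X S T ≠ ∞) (hX' : powVar q X' S T ≠ ∞) :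
    ∃ B : ℝ, 0 ≤ B ∧ ∀ s t, S ≤ s → s ≤ t → t ≤ T → X s = X' s →
      powVar (q / α) (fun u => f (X u) - f (X' u)) s t ≠ ∞ ∧
      varControl (q / α) (fun u => f (X u) - f (X' u)) s t ^ (1 / (q / α)) ≤
        B * varControl q (fun u => X u - X' u) s t ^ (1 / q) := by
  have hq0 : 0 < q := by linarith
  set r : ℝ := q / α with hr
  have hqr : q ≤ r := by rw [hr, le_div_iff₀ hα]; nlinarith
  have hr1 : 1 ≤ r := hq.trans hqr
  have hr0 : 0 < r := by linarith
  have hαr : α * r = q := by rw [hr]; field_simp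
  set Ω : ℝ → ℝ → ℝ := fun a b => varControl q X a b + varControl q X' a b with hΩ
  have hΩc : IsControl Ω S T := (isControl_varControl hX).add (isControl_varControl hX')
  set c₁ : ℝ := 2 ^ (r - 1) * L ^ r with hc₁
  set c₂ : ℝ := 2 ^ (r - 1) * N ^ r * 2 ^ (q - 1) with hc₂
  have hc₁0 : 0 ≤ c₁ := by positivity
  have hc₂0 : 0 ≤ c₂ := by positivity
  -- This is the total of the two terms of the control built below, each being a multiple of `D ^
  -- r`. The absolute value makes `A` nonnegative before any ordering of `S` and `T` is known.
  set A : ℝ := c₁ + c₂ * |Ω S T| with hA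
  have hA0 : 0 ≤ A := by positivity
  refine ⟨A ^ (1 / r), by positivity, fun s t hs hst ht hXs => ?_⟩
  have hW : powVar q (fun u => X u - X' u) s t ≠ ∞ :=
    ne_top_of_le_ne_top (powVar_sub_ne_top hq hX hX') (powVar_mono q _ hs ht)
  set W : ℝ → E := fun u => X u - X' u with hWdef
  set D : ℝ := varControl q W s t ^ (1 / q) with hD
  have hD0 : 0 ≤ D := Real.rpow_nonneg (varControl_nonneg _ _ _ _) _
  have hDq : varControl q W s t = D ^ q := by
    rw [hD, ← Real.rpow_mul (varControl_nonneg _ _ _ _), one_div_mul_cancel hq0.ne', Real.rpow_one]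
  -- `D` bounds every increment of `W` and, as `W s = 0`, also `W` itself. This is where the common
  -- starting point enters.
  have hWD : ∀ a b, s ≤ a → a ≤ b → b ≤ t → ‖W b - W a‖ ≤ D := fun a b ha hab hb =>
    (norm_le_varControl_rpow hq0 hW ha hab hb).trans
      (Real.rpow_le_rpow (varControl_nonneg _ _ _ _)
        ((isControl_varControl hW).mono le_rfl ha hab hb le_rfl) (by positivity))
  have hWa : ∀ a, s ≤ a → a ≤ t → ‖X a - X' a‖ ≤ D := fun a ha hat => by
    have := hWD s a le_rfl ha hat
    simpa [hWdef, hXs] using this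
  have hφ : IsControl (fun a b => c₁ * D ^ (r - q) * varControl q W a b + c₂ * D ^ r * Ω a b) s t :=
    ((isControl_varControl hW).const_mul (by positivity)).add
      ((hΩc.restrict hs ht).const_mul (by positivity))
  have hinc : ∀ a b, s ≤ a → a ≤ b → b ≤ t →
      ‖(f (X b) - f (X' b)) - (f (X a) - f (X' a))‖ ^ r ≤
        c₁ * D ^ (r - q) * varControl q W a b + c₂ * D ^ r * Ω a b := by
    intro a b ha hab hb
    set U : ℝ := ‖X b - X a‖ + ‖X' b - X' a‖ with hU
    have hU0 : 0 ≤ U := by positivity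
    have e1 := norm_second_difference_le hα.le hN hf hL hHol (X a) (X b) (X' a) (X' b)
    have e2 : ‖(f (X b) - f (X' b)) - (f (X a) - f (X' a))‖ ≤
        L * ‖W b - W a‖ + N * U ^ α * D :=
      e1.trans (add_le_add le_rfl
        (mul_le_mul_of_nonneg_left (hWa a ha (hab.trans hb)) (by positivity)))
    refine (Real.rpow_le_rpow (norm_nonneg _) e2 hr0.le).trans
      ((add_rpow_le_mul_rpow_add_rpow (by positivity) (by positivity) hr1).trans ?_)
    have e3 : ‖W b - W a‖ ^ r ≤ D ^ (r - q) * varControl q W a b :=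
      (rpow_le_rpow_sub_mul hq0 hqr (norm_nonneg _) (hWD a b ha hab hb)).trans
        (mul_le_mul_of_nonneg_left (norm_rpow_le_varControl hW ha hab hb) (by positivity))
    have e4 : U ^ q ≤ 2 ^ (q - 1) * Ω a b :=
      (add_rpow_le_mul_rpow_add_rpow (norm_nonneg _) (norm_nonneg _) hq).trans
        (mul_le_mul_of_nonneg_left (add_le_add
          (norm_rpow_le_varControl hX (hs.trans ha) hab (hb.trans ht))
          (norm_rpow_le_varControl hX' (hs.trans ha) hab (hb.trans ht))) (by positivity))
    -- Since `α * r = q`, the factor `U ^ α` raised to the power `r` is `U ^ q`, which the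
    -- `q`-variations of `X` and `X'` control.
    rw [Real.mul_rpow hL0 (norm_nonneg _), Real.mul_rpow (by positivity) hD0,
      Real.mul_rpow hN (by positivity), ← Real.rpow_mul hU0, hαr]
    calc 2 ^ (r - 1) * (L ^ r * ‖W b - W a‖ ^ r + N ^ r * U ^ q * D ^ r)
        ≤ 2 ^ (r - 1) * (L ^ r * (D ^ (r - q) * varControl q W a b)
            + N ^ r * (2 ^ (q - 1) * Ω a b) * D ^ r) := by gcongr
      _ = c₁ * D ^ (r - q) * varControl q W a b + c₂ * D ^ r * Ω a b := by
          rw [hc₁, hc₂]; ring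
  refine ⟨powVar_ne_top_of_control hr0.le hφ hinc, ?_⟩
  have hle := varControl_le_of_control hr0.le hst hφ hinc
  have hDr : D ^ (r - q) * D ^ q = D ^ r := by
    rw [← Real.rpow_add_of_nonneg hD0 (by linarith) hq0.le]
    ring_nf
  have hle2 : varControl r (fun u => f (X u) - f (X' u)) s t ≤ A * D ^ r := by
    refine hle.trans ?_
    rw [hDq, mul_assoc, hDr, hA, add_mul]
    have : Ω s t ≤ |Ω S T| := (hΩc.mono le_rfl hs hst ht le_rfl).trans (le_abs_self _)
    have h2 : c₂ * D ^ r * Ω s t ≤ c₂ * D ^ r * |Ω S T| :=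
      mul_le_mul_of_nonneg_left this (by positivity)
    linarith
  refine (Real.rpow_le_rpow (varControl_nonneg _ _ _ _) hle2 (by positivity)).trans (le_of_eq ?_)
  rw [Real.mul_rpow hA0 (by positivity), ← Real.rpow_mul hD0, mul_one_div_cancel hr0.ne',
    Real.rpow_one]

end Stein

end Sweeping

namespace Sweeping

/-! ### Absorption of the variation -/

section Absorption

variable {E : Type*} [NormedAddCommGroup E]

/-- A self-improvement estimate: the variation of `W` is bounded by that of `h`. -/
theorem varControl_le_of_norm_sq_le {q K : ℝ} (hq0 : 0 < q) (hK : 0 ≤ K) {W h : ℝ → E} {s t : ℝ}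
    (hst : s ≤ t) (hW : powVar q W s t ≠ ∞) (hh : powVar q h s t ≠ ∞)
    (hle : ∀ u v, s ≤ u → u ≤ v → v ≤ t → ‖W v - W u‖ ^ 2 ≤
      K * (varControl q W u v ^ (1 / q) * varControl q h u v ^ (1 / q))) :
    varControl q W s t ≤ K ^ q * varControl q h s t := by
  -- By the arithmetic-geometric mean inequality, `(‖W(u,v)‖^q)² ≤ K^q w k` gives `‖W(u,v)‖^q ≤ w /
  -- 2 + K^q k / 2`. The right side is superadditive, so it dominates the variation of `W`, and the
  -- finite half `w / 2` moves to the left.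
  have hc : IsControl (fun a b => 1 / 2 * varControl q W a b + K ^ q / 2 * varControl q h a b) s t :=
    ((isControl_varControl hW).const_mul (by norm_num)).add
      ((isControl_varControl hh).const_mul (by positivity))
  have hfin := varControl_le_of_control hq0.le hst hc fun u v hu huv hv => by
    set w := varControl q W u v
    set k := varControl q h u v
    have hw : 0 ≤ w := varControl_nonneg _ _ _ _
    have hk : 0 ≤ k := varControl_nonneg _ _ _ _
    set N := ‖W v - W u‖
    have hN : 0 ≤ N := norm_nonneg _
    have e1 : (N ^ q) ^ 2 ≤ K ^ q * (w * k) := by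
      have e2 := Real.rpow_le_rpow (by positivity) (hle u v hu huv hv) hq0.le
      rw [Real.mul_rpow hK (by positivity), Real.mul_rpow (by positivity) (by positivity),
        ← Real.rpow_mul hw, ← Real.rpow_mul hk, one_div_mul_cancel hq0.ne', Real.rpow_one,
        Real.rpow_one] at e2
      have e3 : (N ^ q) ^ 2 = (N ^ 2) ^ q := by
        rw [← Real.rpow_natCast, ← Real.rpow_natCast, ← Real.rpow_mul hN, ← Real.rpow_mul hN,
          mul_comm]
      rw [e3]
      exact e2
    have hKq : 0 ≤ K ^ q := by positivity
    refine abs_le_of_sq_le_sq' ?_ (by positivity) |>.2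
    nlinarith [sq_nonneg (w - K ^ q * k)]
  linarith

end Absorption

/-! ### The energy estimate -/

section Energy

variable {E : Type*} [NormedAddCommGroup E] [InnerProductSpace ℝ E]

/-- Telescoping of `‖W (τ i) - W u‖²`: each step contributes twice the inner product with the
increment of `W = V + h`, plus the square of that increment. -/
theorem norm_sq_eq_leftSum (W V h : ℝ → E) {n : ℕ} {τ : ℕ → ℝ} {u v : ℝ}
    (hτ : IsDissection n τ u v) (hV : ∀ r ∈ Icc u v, V r = W r - h r) :
    ‖W v - W u‖ ^ 2 = 2 * leftSum (fun r => innerSL ℝ (W r - W u)) V n τ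
      + 2 * leftSum (fun r => innerSL ℝ (W r - W u)) h n τ
      + ∑ i ∈ Finset.range n, ‖W (τ (i + 1)) - W (τ i)‖ ^ 2 := by
  have h1 : ‖W v - W u‖ ^ 2 = ∑ i ∈ Finset.range n,
      (‖W (τ (i + 1)) - W u‖ ^ 2 - ‖W (τ i) - W u‖ ^ 2) := by
    rw [Finset.sum_range_sub (fun i => ‖W (τ i) - W u‖ ^ 2), hτ.left, hτ.right]
    simp
  rw [h1]
  unfold leftSum
  rw [Finset.mul_sum, Finset.mul_sum, ← Finset.sum_add_distrib, ← Finset.sum_add_distrib]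
  refine Finset.sum_congr rfl fun i hi => ?_
  have hi' := Finset.mem_range.1 hi
  rw [hV _ (hτ.mem_Icc (show i + 1 ≤ n by omega)), hV _ (hτ.mem_Icc (show i ≤ n by omega))]
  have e : W (τ (i + 1)) - W u = (W (τ i) - W u) + (W (τ (i + 1)) - W (τ i)) := by abel
  have e2 : W (τ (i + 1)) - h (τ (i + 1)) - (W (τ i) - h (τ i)) =
      (W (τ (i + 1)) - W (τ i)) - (h (τ (i + 1)) - h (τ i)) := by abel
  rw [e, norm_add_sq_real, e2]
  simp only [innerSL_apply_apply, inner_sub_right]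
  ring

/-- The energy estimate `‖W(u,v)‖² ≤ 2 ∫ ⟨W(u,·), dh⟩` when `∫ ⟨W(u,·), d(W - h)⟩ ≤ 0`, combined with
Young's inequality. -/
theorem norm_sq_le_of_youngIntegral_nonpos {q : ℝ} (hq1 : 1 ≤ q) (hq2 : q < 2) {W V h : ℝ → E}
    {u v I : ℝ} (huv : u ≤ v) (hWc : ContinuousOn W (Icc u v)) (hW : powVar q W u v ≠ ∞)
    (hh : powVar q h u v ≠ ∞) (hV : ∀ r ∈ Icc u v, V r = W r - h r)
    (hI : IsYoungIntegral (fun r => innerSL ℝ (W r - W u)) V u v I) (hI0 : I ≤ 0) :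
    ‖W v - W u‖ ^ 2 ≤ 2 * youngConst (1 / q + 1 / q) *
      (varControl q W u v ^ (1 / q) * varControl q h u v ^ (1 / q)) := by
  have hq0 : 0 < q := by linarith
  refine le_of_forall_pos_le_add fun ε hε => ?_
  obtain ⟨η, hη, hηε⟩ := exists_pos_rpow_mul_lt (sub_pos.2 hq2) (varControl_nonneg q W u v)
    (half_pos hε)
  obtain ⟨δ₁, hδ₁, hd₁⟩ := hWc.exists_norm_sub_lt_of_Icc hη
  obtain ⟨δ₂, hδ₂, hd₂⟩ := hI (ε / 4) (by positivity)
  obtain ⟨n, τ, hτ, hmesh⟩ := exists_isDissection_mesh_lt huv (lt_min hδ₁ hδ₂)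
  have e1 : |leftSum (fun r => innerSL ℝ (W r - W u)) V n τ - I| < ε / 4 :=
    hd₂ n τ hτ fun i hi => (hmesh i hi).trans_le (min_le_right _ _)
  have hrec : 1 < 1 / q + 1 / q := by
    rw [← add_div, lt_div_iff₀ hq0]; linarith
  have e2 := norm_leftSum_sub_le (y := fun r => innerSL ℝ (W r - W u)) (z := h)
    (by positivity : 0 < 1 / q) (by positivity : 0 < 1 / q) hrec
    (isControl_varControl hW) (isControl_varControl hh)
    (fun a b ha hab hb => by
      have : innerSL ℝ (W b - W u) - innerSL ℝ (W a - W u) = innerSL ℝ (W b - W a) := by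
        rw [← map_sub]; congr 1; abel
      rw [this, innerSL_apply_norm]
      exact norm_le_varControl_rpow hq0 hW ha hab hb)
    (fun a b ha hab hb => norm_le_varControl_rpow hq0 hh ha hab hb) hτ
  -- The integrand vanishes at `u`, so the leading term of Young's inequality is zero and only the
  -- product of variations remains.
  simp only [sub_self, map_zero, zero_apply, sub_zero] at e2
  -- The squared increments sum to at most `η ^ (2 - q)` times the `q`-variation control, which is
  -- small because `q < 2`.
  have e3 : ∑ i ∈ Finset.range n, ‖W (τ (i + 1)) - W (τ i)‖ ^ 2 ≤
      η ^ (2 - q) * varControl q W u v := by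
    obtain ⟨-, hsum⟩ := (isControl_varControl hW).sum_le n hτ.mono hτ.left.ge hτ.right.le
    rw [hτ.left, hτ.right] at hsum
    refine le_trans ?_ (mul_le_mul_of_nonneg_left hsum (by positivity))
    rw [Finset.mul_sum]
    refine Finset.sum_le_sum fun i hi => ?_
    have hi' := Finset.mem_range.1 hi
    have m1 := (hτ.mem_Icc (show i ≤ n by omega)).1
    have m2 := hτ.mono i hi'
    have m3 := (hτ.mem_Icc (show i + 1 ≤ n by omega)).2
    have e := rpow_le_rpow_sub_mul hq0 hq2.le (norm_nonneg _)
      (hd₁ _ _ m1 m2 m3 ((hmesh i hi').trans_le (min_le_left _ _))).le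
    rw [Real.rpow_two] at e
    exact e.trans (mul_le_mul_of_nonneg_left (norm_rpow_le_varControl hW m1 m2 m3)
      (by positivity))
  rw [norm_sq_eq_leftSum W V h hτ hV]
  have e4 := (abs_lt.1 e1).2
  have e5 := (le_abs_self _).trans e2
  linarith

theorem incrementMonotone_of_eqOn {X Y X' Y' : ℝ → E} {s t : ℝ}
    (h : ∀ r ∈ Icc s t, Y r - Y s = Y' r - Y' s) : IncrementMonotone X Y X' Y' s t := by
  intro u v hu huv hv
  refine ⟨0, fun ε hε => ⟨1, one_pos, fun n τ hτ _ => ?_⟩, le_rfl⟩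
  have hconst : ∀ i ≤ n, Y (τ i) - Y' (τ i) = Y s - Y' s := fun i hi => by
    have hm := hτ.mem_Icc hi
    have := h (τ i) ⟨hu.trans hm.1, hm.2.trans hv⟩
    rw [sub_eq_sub_iff_sub_eq_sub]
    exact this
  rw [Finset.sum_eq_zero fun i hi => ?_]
  · simpa using hε
  · have := Finset.mem_range.1 hi
    beta_reduce
    rw [hconst i (by omega), hconst (i + 1) (by omega), sub_self, map_zero]

end Energy

/-! ### Regularity and uniqueness of solutions -/

section Solution

variable {E : Type*} [NormedAddCommGroup E] [InnerProductSpace ℝ E]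
  {F : Type*} [NormedAddCommGroup F] [NormedSpace ℝ F]

theorem IsCpVar.exists_norm_le {G : Type*} [NormedAddCommGroup G] {p : ℝ} {x : ℝ → G} {s t : ℝ}
    (h : IsCpVar p x s t) : ∃ M, ∀ u ∈ Icc s t, ‖x u‖ ≤ M :=
  isCompact_Icc.exists_bound_of_continuousOn h.continuousOn

/-- The first component of a solution is continuous with the finite variation of the driver. -/
theorem continuousOn_and_powVar_ne_top {T p q r : ℝ} (hp : 1 ≤ p) (hpq : p < q)
    (hr : 1 ≤ r) (hqr : 1 < 1 / r + 1 / q) {y : ℝ → F →L[ℝ] E} {Z : ℝ → F}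
    (hZ : IsCpVar p Z 0 T) (hy : IsCpVar r y 0 T) {X Y H : ℝ → E}
    (hX : ∀ t ∈ Icc 0 T, X t = H t + Y t)
    (hH : ∀ t ∈ Icc 0 T, IsYoungIntegral y Z 0 t (H t))
    (hYc : ContinuousOn Y (Icc 0 T)) (hY : BoundedVariationOn Y (Icc 0 T)) :
    ContinuousOn X (Icc 0 T) ∧ powVar q X 0 T ≠ ∞ := by
  have hq0 : 0 < q := by linarith
  have hr0 : 0 < r := by linarith
  have hyv := hy.powVar_ne_top hr0
  have hZp := hZ.powVar_ne_top (by linarith)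
  have hZq := powVar_ne_top_of_le (by linarith) hpq.le hZp
  obtain ⟨M, hM⟩ := hy.exists_norm_le
  set A : ℝ := |M + youngConst (1 / r + 1 / q) * varControl r y 0 T ^ (1 / r)|
  have hA : 0 ≤ A := abs_nonneg _
  have hinc : ∀ a b, 0 ≤ a → a ≤ b → b ≤ T →
      ‖H b - H a‖ ≤ A * varControl q Z a b ^ (1 / q) := fun a b ha hab hb =>
    (norm_youngIntegral_le hr0 hq0 hqr hyv hZq hM ha hab hb
      ((hH a ⟨ha, hab.trans hb⟩).sub_interval ha (hH b ⟨ha.trans hab, hb⟩))).trans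
      (mul_le_mul_of_nonneg_right (le_abs_self _)
        (Real.rpow_nonneg (varControl_nonneg _ _ _ _) _))
  have hincq : ∀ a b, 0 ≤ a → a ≤ b → b ≤ T → ‖H b - H a‖ ^ q ≤ A ^ q * varControl q Z a b := by
    intro a b ha hab hb
    have := Real.rpow_le_rpow (norm_nonneg _) (hinc a b ha hab hb) hq0.le
    rwa [Real.mul_rpow hA (Real.rpow_nonneg (varControl_nonneg _ _ _ _) _),
      ← Real.rpow_mul (varControl_nonneg _ _ _ _), one_div_mul_cancel hq0.ne',
      Real.rpow_one] at this
  have hHv : powVar q H 0 T ≠ ∞ := powVar_ne_top_of_control hq0.le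
    ((isControl_varControl hZq).const_mul (by positivity)) hincq
  have hHc : ContinuousOn H (Icc 0 T) := by
    -- The increments of `H` are bounded by the `q`-variation of `Z`, small on short intervals since
    -- `q > p`. The 1 in the denominator keeps the threshold meaningful when `A = 0`.
    refine Metric.continuousOn_iff.2 fun b hb ε hε => ?_
    obtain ⟨δ, hδ, hd⟩ := exists_varControl_lt (by linarith) hpq hZ.continuousOn hZp
      (show 0 < ε ^ q / (A ^ q + 1) by positivity)
    have key : ∀ c d, 0 ≤ c → c ≤ d → d ≤ T → d - c < δ → ‖H d - H c‖ < ε := by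
      intro c d hc hcd hdT hdc
      have h1 := hd c d hc hcd hdT hdc
      rw [lt_div_iff₀ (by positivity)] at h1
      have h2 := hincq c d hc hcd hdT
      have h3 := varControl_nonneg q Z c d
      refine lt_of_not_ge fun h4 => ?_
      have h5 := Real.rpow_le_rpow hε.le h4 hq0.le
      nlinarith
    refine ⟨δ, hδ, fun a ha hab => ?_⟩
    rw [Real.dist_eq, abs_lt] at hab
    rcases le_total a b with h | h
    · rw [dist_comm, dist_eq_norm]
      exact key a b ha.1 h hb.2 (by linarith)
    · rw [dist_eq_norm]
      exact key b a hb.1 h ha.2 (by linarith)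
  have hYq := powVar_ne_top_of_le one_pos (by linarith : 1 ≤ q)
    (powVar_one_ne_top_of_boundedVariationOn hY)
  refine ⟨(hHc.add hYc).congr hX, ?_⟩
  rw [powVar_congr (x' := fun u => H u + Y u) hX]
  exact powVar_add_ne_top (by linarith) hHv hYq

/-- All the requirements are strict inequalities that hold at `q = p`, so by continuity they persist
for `q` slightly above `p`. They are what the smallness of `Z`, the energy estimate and the Young
integrals involved need. -/
theorem exists_exponent {p α r r' : ℝ} (hp : 1 ≤ p) (hp2 : p < 2) (hpα : p < 1 + α)
    (hr : 1 < 1 / p + 1 / r) (hr' : 1 < 1 / p + 1 / r') :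
    ∃ q, p < q ∧ q < 2 ∧ q < 1 + α ∧ 1 < 1 / q + 1 / r ∧ 1 < 1 / q + 1 / r' := by
  have hcont : ContinuousAt (fun q : ℝ => 1 / q) p :=
    continuousAt_const.div continuousAt_id (by simp; linarith)
  have h1 := (hcont.add_const (1 / r)).eventually (lt_mem_nhds hr)
  have h2 := (hcont.add_const (1 / r')).eventually (lt_mem_nhds hr')
  have h3 : ∀ᶠ q in 𝓝[>] p, q < 2 ∧ q < 1 + α ∧ 1 < 1 / q + 1 / r ∧ 1 < 1 / q + 1 / r' :=
    nhdsWithin_le_nhds ((gt_mem_nhds hp2).and ((gt_mem_nhds hpα).and (h1.and h2)))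
  obtain ⟨q, hq, hq'⟩ := (h3.and self_mem_nhdsWithin).exists
  exact ⟨q, hq', hq⟩

variable [CompleteSpace E]

/-- If two solutions agree at `s` and their increments are monotone on `[s,t]`, then they agree on
`[s,t]`. -/
theorem IsSolution.eqOn_of_incrementMonotone {T p γ : ℝ} (hT : 0 ≤ T) (hp1 : 1 ≤ p) (hp2 : p < 2)
    (hγ : p < γ) {C : ℝ → Set E} {f : E → F →L[ℝ] E} (hf : IsLipStein γ f) {Z : ℝ → F}
    (hZ : IsCpVar p Z 0 T) {a : E} {X Y X' Y' : ℝ → E}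
    (hXY : IsSolution hT p C f Z a X Y) (hXY' : IsSolution hT p C f Z a X' Y')
    {s t : ℝ} (hs : 0 ≤ s) (ht : t ≤ T) (hXs : X s = X' s)
    (hmon : IncrementMonotone X Y X' Y' s t) :
    ∀ u ∈ Icc s t, X u = X' u ∧ Y u - Y s = Y' u - Y' s := by
  obtain ⟨H, hX, ⟨r, hr1, hr, hfX⟩, hH, hSw, -⟩ := hXY
  obtain ⟨H', hX', ⟨r', hr1', hr', hfX'⟩, hH', hSw', -⟩ := hXY'
  obtain ⟨α, L, N, hα, hα1, hpα, hL0, hN, hfd, hL, hHol⟩ := hf.exists_holder_fderiv hp1 hp2 hγ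
  obtain ⟨q, hpq, hq2, hqα, hqr, hqr'⟩ := exists_exponent hp1 hp2 hpα hr hr'
  have hq1 : 1 ≤ q := by linarith
  have hq0 : 0 < q := by linarith
  obtain ⟨hXc, hXv⟩ := continuousOn_and_powVar_ne_top hp1 hpq hr1 (by rwa [add_comm] at hqr) hZ hfX
    hX hH hSw.continuousOn hSw.boundedVariationOn
  obtain ⟨hXc', hXv'⟩ := continuousOn_and_powVar_ne_top hp1 hpq hr1' (by rwa [add_comm] at hqr') hZ
    hfX' hX' hH' hSw'.continuousOn hSw'.boundedVariationOn
  have hZp := hZ.powVar_ne_top (by linarith)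
  have hZq := powVar_ne_top_of_le (by linarith) hpq.le hZp
  obtain ⟨B, hB0, hB⟩ := exists_varControl_comp_sub_le hα hα1 hL0 hN hq1 hfd hL hHol hXv hXv'
  set W : ℝ → E := fun u => X u - X' u with hWdef
  set h : ℝ → E := fun u => H u - H' u with hhdef
  set y : ℝ → F →L[ℝ] E := fun u => f (X u) - f (X' u) with hydef
  have hWc : ContinuousOn W (Icc 0 T) := hXc.sub hXc'
  have hWv : powVar q W 0 T ≠ ∞ := powVar_sub_ne_top hq1 hXv hXv'
  have hqa0 : 0 < q / α := by positivity
  have hqa : 1 < 1 / (q / α) + 1 / q := by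
    rw [one_div_div, ← add_div, lt_div_iff₀ hq0]
    linarith
  set θ := 1 / (q / α) + 1 / q with hθ
  -- `L` comes from the supremum of `f ∘ X - f ∘ X'`, and `youngConst θ * B` from its
  -- `q/α`-variation through Young's inequality.
  set A : ℝ := L + youngConst θ * B with hA
  have hA0 : 0 ≤ A := add_nonneg hL0 (mul_nonneg (youngConst_nonneg _) hB0)
  set K : ℝ := 2 * youngConst (1 / q + 1 / q) with hK
  have hK0 : 0 ≤ K := mul_nonneg zero_le_two (youngConst_nonneg _)
  have hInt : ∀ a b, 0 ≤ a → a ≤ b → b ≤ T → IsYoungIntegral y Z a b (h b - h a) := by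
    intro a b ha hab hb
    have h1 := (hH a ⟨ha, hab.trans hb⟩).sub_interval ha (hH b ⟨ha.trans hab, hb⟩)
    have h2 := (hH' a ⟨ha, hab.trans hb⟩).sub_interval ha (hH' b ⟨ha.trans hab, hb⟩)
    have h3 := h1.sub h2
    rwa [sub_sub_sub_comm] at h3
  -- on an interval starting at a coincidence point, `h` is controlled by `W` and `Z`
  have hstep : ∀ c d, s ≤ c → c ≤ d → d ≤ t → X c = X' c →
      varControl q W c d ≤ K ^ q * (A ^ q * varControl q Z c d * varControl q W c d) := by
    intro c d hc hcd hd hXc0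
    have hc0 : 0 ≤ c := hs.trans hc
    have hdT : d ≤ T := hd.trans ht
    obtain ⟨hyv, hyB⟩ := hB c d hc0 hcd hdT hXc0
    have hWcd : powVar q W c d ≠ ∞ := ne_top_of_le_ne_top hWv (powVar_mono q W hc0 hdT)
    have hZcd : powVar q Z c d ≠ ∞ := ne_top_of_le_ne_top hZq (powVar_mono q Z hc0 hdT)
    set D : ℝ := varControl q W c d ^ (1 / q) with hD
    have hD0 : 0 ≤ D := Real.rpow_nonneg (varControl_nonneg _ _ _ _) _
    have hDq : D ^ q = varControl q W c d := by
      rw [hD, ← Real.rpow_mul (varControl_nonneg _ _ _ _), one_div_mul_cancel hq0.ne',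
        Real.rpow_one]
    have hWD : ∀ u ∈ Icc c d, ‖X u - X' u‖ ≤ D := fun u hu => by
      have e := (norm_le_varControl_rpow hq0 hWcd le_rfl hu.1 hu.2).trans
        (Real.rpow_le_rpow (varControl_nonneg _ _ _ _)
          ((isControl_varControl hWcd).mono le_rfl le_rfl hu.1 hu.2 le_rfl)
          (by positivity : 0 ≤ 1 / q))
      simpa only [hWdef, hXc0, sub_self, sub_zero] using e
    have hyL : ∀ u ∈ Icc c d, ‖y u‖ ≤ L * D := fun u hu =>
      (norm_sub_le_of_fderiv_bound hfd hL (X' u) (X u)).trans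
        (mul_le_mul_of_nonneg_left (hWD u hu) hL0)
    have hincq : ∀ a b, c ≤ a → a ≤ b → b ≤ d →
        ‖h b - h a‖ ^ q ≤ (A * D) ^ q * varControl q Z a b := by
      intro a b ha hab hb
      have e1 := norm_youngIntegral_le hqa0 hq0 hqa hyv hZcd hyL ha hab hb
        (hInt a b (hc0.trans ha) hab (hb.trans hdT))
      have e2 : L * D + youngConst θ * varControl (q / α) y c d ^ (1 / (q / α)) ≤ A * D := by
        rw [hA, add_mul, mul_assoc]
        exact add_le_add le_rfl (mul_le_mul_of_nonneg_left hyB (youngConst_nonneg _))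
      have e3 := Real.rpow_le_rpow (norm_nonneg _) (e1.trans (mul_le_mul_of_nonneg_right e2
        (Real.rpow_nonneg (varControl_nonneg _ _ _ _) _))) hq0.le
      rwa [Real.mul_rpow (by positivity) (Real.rpow_nonneg (varControl_nonneg _ _ _ _) _),
        ← Real.rpow_mul (varControl_nonneg _ _ _ _), one_div_mul_cancel hq0.ne',
        Real.rpow_one] at e3
    have hctl : IsControl (fun a b => (A * D) ^ q * varControl q Z a b) c d :=
      (isControl_varControl hZcd).const_mul (by positivity)
    have hhv := powVar_ne_top_of_control hq0.le hctl hincq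
    have hhle := varControl_le_of_control hq0.le hcd hctl hincq
    rw [Real.mul_rpow hA0 hD0, hDq] at hhle
    refine (varControl_le_of_norm_sq_le hq0 hK0 hcd hWcd hhv fun u v hu huv hv => ?_).trans
      (mul_le_mul_of_nonneg_left (hhle.trans (le_of_eq (by ring))) (by positivity))
    -- The monotonicity condition is available for `u < v` only; for `u = v` the left side is zero.
    rcases huv.eq_or_lt with rfl | huv'
    · rw [sub_self, norm_zero]
      have := varControl_nonneg q W u u
      have := varControl_nonneg q h u u
      rw [zero_pow two_ne_zero]
      positivity
    · obtain ⟨I, hI, hI0⟩ := hmon u v (hc.trans hu) huv' (hv.trans hd)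
      have hu0 : 0 ≤ u := hc0.trans hu
      have hvT : v ≤ T := hv.trans hdT
      refine norm_sq_le_of_youngIntegral_nonpos (V := fun r => Y r - Y' r) hq1 hq2 huv
        (hWc.mono (Icc_subset_Icc hu0 hvT))
        (ne_top_of_le_ne_top hWcd (powVar_mono q W hu hv))
        (ne_top_of_le_ne_top hhv (powVar_mono q h hu hv)) (fun r hr => ?_) ?_ hI0
      · have hr0 : r ∈ Icc 0 T := ⟨hu0.trans hr.1, hr.2.trans hvT⟩
        simp only [hWdef, hhdef]
        rw [hX r hr0, hX' r hr0]
        abel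
      · have e : (fun r => innerSL ℝ (W r - W u)) =
            fun r => innerSL ℝ ((X r - X u) - (X' r - X' u)) := by
          funext r
          simp only [hWdef]
          congr 1
          abel
        rw [e]
        exact hI
  -- Below this threshold the factor `K^q A^q varControl q Z c d` is less than 1, so `hstep` forces
  -- the variation of `W` on `[c,d]` to vanish.
  obtain ⟨δ, hδ, hsmall⟩ := exists_varControl_lt (by linarith) hpq hZ.continuousOn hZp
    (show 0 < 1 / (K ^ q * A ^ q + 1) by positivity)
  have hlocal : ∀ c d, s ≤ c → c ≤ d → d ≤ t → d - c < δ → X c = X' c → X d = X' d := by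
    intro c d hc hcd hd hdc hXc0
    have h1 := hstep c d hc hcd hd hXc0
    have h2 := hsmall c d (hs.trans hc) hcd (hd.trans ht) hdc
    rw [lt_div_iff₀ (by positivity)] at h2
    have h3 := varControl_nonneg q W c d
    have h4 := varControl_nonneg q Z c d
    have h5 : varControl q W c d = 0 := by
      by_contra hne
      have hpos : 0 < varControl q W c d := lt_of_le_of_ne h3 (Ne.symm hne)
      have h6 : K ^ q * (A ^ q * varControl q Z c d * varControl q W c d) =
        (varControl q Z c d * (K ^ q * A ^ q + 1) - varControl q Z c d)
          * varControl q W c d := by ring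
      rw [h6] at h1
      nlinarith
    have h7 := norm_le_varControl_rpow hq0 hWv (hs.trans hc) hcd (hd.trans ht)
    rw [h5, Real.zero_rpow (by positivity)] at h7
    have h8 : W d - W c = 0 := norm_le_zero_iff.1 h7
    simp only [hWdef, hXc0, sub_self, sub_zero] at h8
    exact sub_eq_zero.1 h8
  -- Steps of length `δ / 2` meet the strict bound `d - c < δ`, and each one ends at a new
  -- coincidence point.
  have hall : ∀ n : ℕ, ∀ u ∈ Icc s t, u ≤ s + n * (δ / 2) → X u = X' u := by
    intro n
    induction n with
    | zero =>
      intro u hu hle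
      have : u = s := le_antisymm (by simpa using hle) hu.1
      rw [this, hXs]
    | succ n ih =>
      intro u hu hle
      push_cast at hle
      rcases le_total u (s + n * (δ / 2)) with h1 | h1
      · exact ih u hu h1
      · have hn : 0 ≤ (n : ℝ) * (δ / 2) := by positivity
        exact hlocal (s + n * (δ / 2)) u (by linarith) h1 hu.2 (by linarith)
          (ih _ ⟨by linarith, h1.trans hu.2⟩ le_rfl)
  have hXeq : ∀ u ∈ Icc s t, X u = X' u := by
    intro u hu
    obtain ⟨n, hn⟩ := exists_nat_ge ((u - s) / (δ / 2))
    rw [div_le_iff₀ (by positivity)] at hn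
    exact hall n u hu (by linarith)
  refine fun u hu => ⟨hXeq u hu, ?_⟩
  have hu0 : 0 ≤ u := hs.trans hu.1
  have huT : u ≤ T := hu.2.trans ht
  -- the integrals agree since the integrands do
  have hzero : ‖h u - h s - 0‖ ≤ 0 := (hInt s u hs hu.1 huT).norm_sub_le_of_leftSum hu.1
    fun n τ hτ => by
      have : leftSum y Z n τ = 0 := Finset.sum_eq_zero fun i hi => by
        have := Finset.mem_range.1 hi
        have hm := hτ.mem_Icc (show i ≤ n by omega)
        simp only [hydef]
        rw [hXeq _ ⟨hm.1, hm.2.trans hu.2⟩, sub_self, zero_apply]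
      simp [this]
  rw [sub_zero] at hzero
  have hz : h u = h s := sub_eq_zero.1 (norm_le_zero_iff.1 hzero)
  have k1 : Y u = X u - H u := eq_sub_of_add_eq' (hX u ⟨hu0, huT⟩).symm
  have k2 : Y s = X s - H s := eq_sub_of_add_eq' (hX s ⟨hs, hu.1.trans huT⟩).symm
  have k3 : Y' u = X' u - H' u := eq_sub_of_add_eq' (hX' u ⟨hu0, huT⟩).symm
  have k4 : Y' s = X' s - H' s := eq_sub_of_add_eq' (hX' s ⟨hs, hu.1.trans huT⟩).symm
  have hz' : H u = H s - H' s + H' u := eq_add_of_sub_eq hz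
  rw [k1, k2, k3, k4, hXeq u hu, hXs, hz']
  abel

theorem IsSolution.initial {T p : ℝ} (hT : 0 ≤ T) {C : ℝ → Set E} {f : E → F →L[ℝ] E} {Z : ℝ → F}
    {a : E} {X Y : ℝ → E} (h : IsSolution hT p C f Z a X Y) : Y 0 = a := by
  obtain ⟨_, _, _, _, _, h0⟩ := h
  exact h0

end Solution

end Sweeping

/-! ### The three equivalences -/

theorem mainTheorem4 (e d : ℕ) (T : ℝ) (hT : 0 ≤ T) (p : ℝ) (hp1 : 1 ≤ p) (hp2 : p < 2)
    (γ : ℝ) (hγ : p < γ)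
    (C : ℝ → Set (EuclideanSpace ℝ (Fin e)))
    (hC : Sweeping.ConstraintAssumption T C)
    (f : EuclideanSpace ℝ (Fin e) → EuclideanSpace ℝ (Fin d) →L[ℝ] EuclideanSpace ℝ (Fin e))
    (hf : Sweeping.IsLipStein γ f)
    (Z : ℝ → EuclideanSpace ℝ (Fin d)) (hZ : Sweeping.IsCpVar p Z 0 T)
    (a : EuclideanSpace ℝ (Fin e))
    (X Y X' Y' : ℝ → EuclideanSpace ℝ (Fin e))
    (hXY : Sweeping.IsSolution hT p C f Z a X Y)
    (hXY' : Sweeping.IsSolution hT p C f Z a X' Y')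
    (s t : ℝ) (hs : 0 ≤ s) (hst : s < t) (ht : t ≤ T) :
    ((∀ r ∈ Set.Icc s t, X r = X' r ∧ Y r - Y s = Y' r - Y' s) ↔
      (X s = X' s ∧ Sweeping.IncrementMonotone X Y X' Y' s t)) ∧
    ((∀ r ∈ Set.Icc s t, X r = X' r ∧ Y r = Y' r) ↔
      (X s = X' s ∧ Y s = Y' s ∧ Sweeping.IncrementMonotone X Y X' Y' s t)) ∧
    (s = 0 → ((∀ r ∈ Set.Icc s t, X r = X' r ∧ Y r = Y' r) ↔
      (X s = X' s ∧ Sweeping.IncrementMonotone X Y X' Y' s t))) := by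
  have back := fun (hX : X s = X' s) (hm : Sweeping.IncrementMonotone X Y X' Y' s t) =>
    Sweeping.IsSolution.eqOn_of_incrementMonotone hT hp1 hp2 hγ hf hZ hXY hXY' hs ht hX hm
  have hss : s ∈ Set.Icc s t := ⟨le_rfl, hst.le⟩
  have part2 : (∀ r ∈ Set.Icc s t, X r = X' r ∧ Y r = Y' r) ↔
      (X s = X' s ∧ Y s = Y' s ∧ Sweeping.IncrementMonotone X Y X' Y' s t) := by
    refine ⟨fun h => ⟨(h s hss).1, (h s hss).2, Sweeping.incrementMonotone_of_eqOn fun r hr => ?_⟩,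
      fun ⟨hX, hY, hm⟩ r hr => ⟨(back hX hm r hr).1, ?_⟩⟩
    · rw [(h r hr).2, (h s hss).2]
    · have h := (back hX hm r hr).2
      rw [hY] at h
      exact sub_left_injective h
  refine ⟨⟨fun h => ⟨(h s hss).1, Sweeping.incrementMonotone_of_eqOn fun r hr => (h r hr).2⟩,
    fun ⟨hX, hm⟩ => back hX hm⟩, part2, fun h0 => part2.trans ?_⟩
  -- At time 0 both solutions satisfy `Y 0 = a`, so the condition on `Y s` in the second equivalence
  -- is automatic.
  have hY : Y s = Y' s := by rw [h0, hXY.initial, hXY'.initial]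
  exact ⟨fun ⟨hX, _, hm⟩ => ⟨hX, hm⟩, fun ⟨hX, hm⟩ => ⟨hX, hY, hm⟩⟩
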